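/- Let $\omega,\gamma,\lambda>0$ and $T>0$, and put $\nu^2=\gamma^2/\omega^2$. For $N\in\mathbb N$ consider a chain of $N$ oscillators with positions $q=(q_1,\dots,q_N)$ and momenta $p=(p_1,\dots,p_N)$, boundary values $q_0=q_{N+1}=0$, and Hamiltonian $$H(q,p)=\sum_{i=1}^N\Bigl[\tfrac12p_i^2+\tfrac12\gamma^2q_i^2\Bigr]+\sum_{i=1}^{N+1}\tfrac12\omega^2(q_i-q_{i-1})^2 .$$ Let $X(t)=(q(t),p(t))$, $t\ge0$, be the solution of the Langevin equations $dX=-AX\,dt+\Sigma\,dW$, where $W$ is a standard $2N$-dimensional Brownian motion, $$A=\begin{pmatrix}0&-I\\ \Phi&\lambda I\end{pmatrix},\qquad \Sigma=\begin{pmatrix}0&0\\0&\sqrt{2\lambda T}\,I\end{pmatrix},\qquad \Phi=\omega^2(-\Delta+\nu^2I),$$ $\Delta_{ij}=-2\delta_{i,j}+\delta_{i-1,j}+\delta_{i+1,j}$ is the discrete Dirichlet Laplacian, and $X(0)$ is independent of $W$ and distributed according to the Gibbs measure at temperature $T$, whose density is proportional to $e^{-H/T}$. Let $$J(q,p)=\sum_{i=1}^{N-1}J_i(q,p),\qquad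 J_i(q,p)=-\frac{\omega^2}{2}(q_{i+1}-q_i)(p_i+p_{i+1}),$$ be the total energy current, and let $$C^{(N)}_{JJ}(t;T)=\frac1{N+1}\bigl\langle J(q(t),p(t))\,J(q(0),p(0))\bigr\rangle ,\qquad t\ge0,$$ be its normalized autocorrelation function, where $\langle\cdot\rangle$ is the expectation in this equilibrium dynamics. Then these expectations are well defined, $t\mapsto C^{(N)}_{JJ}(t;T)$ is integrable over $(0,\infty)$ for every $N$, the limit $\lim_{N\to\infty}C^{(N)}_{JJ}(t;T)$ exists for every $t\ge0$ and is integrable in $t$ over $(0,\infty)$, and $$\frac1{T^2}\int_0^\infty\lim_{N\to\infty}C^{(N)}_{JJ}(t;T)\,dt=\lim_{N\to\infty}\frac1{T^2}\int_0^\infty C^{(N)}_{JJ}(t;T)\,dt=\kappa,$$ where $$\kappa=\frac{\omega^2}{\lambda}\,\frac1{2+\nu^2+\sqrt{\nu^2(4+\nu^2)}}$$ is the thermal conductivity of the chain in Fourier's law; in particular, the value does not depend on $T$. -/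

import Mathlib

open MeasureTheory ProbabilityTheory Filter Topology
open scoped NNReal Matrix

namespace HarmonicChain

noncomputable section

/-- Index set of the phase space `ℝ^N × ℝ^N`: `Sum.inl i` labels the position and `Sum.inr i` the
momentum of the particle `i + 1`, `i : Fin N`. -/
abbrev Site (N : ℕ) : Type := Fin N ⊕ Fin N

/-- Phase space points `X = (q, p)`. -/
abbrev Phase (N : ℕ) : Type := Site N → ℝ

/-- The entries `x_1, …, x_N` of a vector in the one-based numbering of the particles, extended by
the boundary values `x_0 = x_{N+1} = 0` (and by `0` beyond). -/
def entry {N : ℕ} (x : Fin N → ℝ) : ℕ → ℝ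
  | 0 => 0
  | k + 1 => if h : k < N then x ⟨k, h⟩ else 0

/-- The position `q_k` of particle `k`, with `q_0 = q_{N+1} = 0`. -/
def pos {N : ℕ} (X : Phase N) (k : ℕ) : ℝ := entry (fun i => X (Sum.inl i)) k

/-- The momentum `p_k` of particle `k`. -/
def mom {N : ℕ} (X : Phase N) (k : ℕ) : ℝ := entry (fun i => X (Sum.inr i)) k

/-- The on-site potential `u(q) = γ² q² / 2`. -/
def onSite (γ q : ℝ) : ℝ := γ ^ 2 * q ^ 2 / 2

/-- The nearest neighbour potential `v(q) = ω² q² / 2`. -/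
def bond (ω q : ℝ) : ℝ := ω ^ 2 * q ^ 2 / 2

/-- `H(q, p) = ∑_{i=1}^N [p_i² / 2 + u(q_i)] + ∑_{i=1}^{N+1} v(q_i - q_{i-1})`. -/
def hamiltonian (ω γ : ℝ) {N : ℕ} (X : Phase N) : ℝ :=
  ∑ i ∈ Finset.Icc 1 N, (mom X i ^ 2 / 2 + onSite γ (pos X i)) +
    ∑ i ∈ Finset.Icc 1 (N + 1), bond ω (pos X i - pos X (i - 1))

/-- The Gibbs measure at temperature `T`, of density `exp (-H / T) / ∫ exp (-H / T)` with respect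
to Lebesgue measure. -/
def gibbs (ω γ T : ℝ) (N : ℕ) : Measure (Phase N) :=
  (volume : Measure (Phase N)).tilted (fun X => -hamiltonian ω γ X / T)

/-- The discrete Laplacian with Dirichlet boundary conditions. -/
def laplacian (N : ℕ) : Matrix (Fin N) (Fin N) ℝ :=
  Matrix.of fun i j =>
    if i = j then -2 else if (i : ℕ) + 1 = j ∨ (j : ℕ) + 1 = i then 1 else 0

/-- The force matrix `Φ = ω² (-Δ + ν² I)`, where `ν² = γ² / ω²`. -/
def forceMatrix (ω γ : ℝ) (N : ℕ) : Matrix (Fin N) (Fin N) ℝ :=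
  ω ^ 2 • (-laplacian N + (γ ^ 2 / ω ^ 2) • (1 : Matrix (Fin N) (Fin N) ℝ))

/-- The drift matrix `A = (0, -I; Φ, lam I)`. -/
def driftMatrix (ω γ lam : ℝ) (N : ℕ) : Matrix (Site N) (Site N) ℝ :=
  Matrix.fromBlocks 0 (-1) (forceMatrix ω γ N) (lam • (1 : Matrix (Fin N) (Fin N) ℝ))

/-- The noise matrix `Σ = (0, 0; 0, √(2 lam 𝒯))` for the bath temperatures `Θ_i`. -/
def noiseMatrix (lam : ℝ) {N : ℕ} (Θ : Fin N → ℝ) : Matrix (Site N) (Site N) ℝ :=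
  Matrix.fromBlocks 0 0 0 (Matrix.diagonal fun i => √(2 * lam * Θ i))

/-- `W` consists of independent standard Brownian motions, `X` is independent of `W` at time zero,
has continuous paths and solves `dX = -A X dt + Σ dW`. As `Σ` is constant, the stochastic
differential equation is the pathwise integral equation
`X(t) = X(0) - ∫_0^t A X(s) ds + Σ W(t)`. -/
structure IsLangevinDynamics (ω γ lam : ℝ) {N : ℕ} (Θ : Fin N → ℝ) {S : Type*}
    [MeasurableSpace S] (P : Measure S) (W : Site N → ℝ≥0 → S → ℝ) (X : ℝ≥0 → S → Phase N) :
    Prop where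
  brownian : ∀ i, IsBrownianReal (W i) P
  indep_noise : iIndepFun (fun (i : Site N) (s : S) (t : ℝ≥0) => W i t s) P
  indep_initial : IndepFun (X 0) (fun (s : S) (i : Site N) (t : ℝ≥0) => W i t s) P
  continuous_paths : ∀ᵐ s ∂P, Continuous fun t : ℝ≥0 => X t s
  equation : ∀ᵐ s ∂P, ∀ t : ℝ≥0,
    X t s = X 0 s - (∫ r in (0 : ℝ)..t, driftMatrix ω γ lam N *ᵥ X r.toNNReal s)
      + noiseMatrix lam Θ *ᵥ fun i => W i t s

/-- The equilibrium dynamics at temperature `T`: all baths have temperature `T` and the initial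
value is distributed according to the Gibbs measure at temperature `T`. -/
structure IsEquilibriumDynamics (ω γ lam T : ℝ) {N : ℕ} {S : Type*} [MeasurableSpace S]
    (P : Measure S) (W : Site N → ℝ≥0 → S → ℝ) (X : ℝ≥0 → S → Phase N) : Prop
    extends IsLangevinDynamics ω γ lam (fun _ : Fin N => T) P W X where
  initial_law : HasLaw (X 0) (gibbs ω γ T N) P

/-- The energy current `J_i = -(ω² / 2) (q_{i+1} - q_i) (p_i + p_{i+1})`. -/
def localCurrent (ω : ℝ) {N : ℕ} (X : Phase N) (i : ℕ) : ℝ :=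
  -(ω ^ 2 / 2) * (pos X (i + 1) - pos X i) * (mom X i + mom X (i + 1))

/-- The total current `J = ∑_{i=1}^{N-1} J_i`. -/
def totalCurrent (ω : ℝ) {N : ℕ} (X : Phase N) : ℝ :=
  ∑ i ∈ Finset.Ico 1 N, localCurrent ω X i

/-- The normalized autocorrelation `⟨J(X(t)) J(X(0))⟩ / (N + 1)` of the total current. -/
def currentCorrelation (ω : ℝ) {N : ℕ} {S : Type*} [MeasurableSpace S] (P : Measure S)
    (X : ℝ≥0 → S → Phase N) (t : ℝ≥0) : ℝ :=
  1 / ((N : ℝ) + 1) * ∫ s, totalCurrent ω (X t s) * totalCurrent ω (X 0 s) ∂P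

/-- The thermal conductivity `κ = (ω² / lam) / (2 + ν² + √(ν² (4 + ν²)))`, where
`ν² = γ² / ω²`. -/
def conductivity (ω γ lam : ℝ) : ℝ :=
  ω ^ 2 / lam *
    (1 / (2 + γ ^ 2 / ω ^ 2 + √(γ ^ 2 / ω ^ 2 * (4 + γ ^ 2 / ω ^ 2))))

end

end HarmonicChain

/-! The dynamics is linear and the current is quadratic, so everything reduces to Gaussian
computations, with constants that must not depend on `N`.

Removing the noise. Variation of constants gives `X(t) = exp(-tA) X(0) + Z` with `Z` square
integrable and independent of `X(0)` (`exists_indep_noise`). Expand `J(X(t)) J(X(0))` in `Z`: the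
term linear in `Z` multiplies an odd function of `X(0)`, the quadratic one multiplies `J(X(0))`, and
both have Gibbs mean zero. Hence the correlation equals `⟨J(exp(-tA) X) J(X)⟩` under the Gibbs
measure (`IsEquilibriumDynamics.integrable_and_integral`).

Closing the equation. Up to a multiple of `q_N p_N - q_1 p_1`, `J` is the bulk current `B = -(ω²/2)
∑ (q_{k+1} - q_{k-1}) p_k`. Along the flow the harmonic forces telescope, so `B' = -lam B - (ω⁴/2)
(q_N² - q_1²)` (`bulkForm_driftL`): apart from boundary terms `B` decays exactly like `exp(-lam t)`.

Boundary terms. The pinning `γ > 0` and a Lyapunov function give exponential decay of the flow, with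
rate and prefactor independent of `N` (`normSq_flow_le`). A boundary term thus has second moment
`O(1)`, while `J` and `B` have second moment `O(N)`. By Cauchy–Schwarz the error is `O(√N)` times an
integrable function of `t`, which vanishes after division by `N + 1`. One bound,
`exists_abs_flowCorrelation_div_sub_le`, therefore serves the pointwise limit and the limit of the
integrals.

The static variance. It remains to find the limit of `⟨B²⟩ / (N + 1)`. The momenta are independent
of the positions, with variance `T`, so it is an average of `⟨(q_{k+1} - q_{k-1})²⟩`. Away from the
ends the position covariance is `T r^|i-j| / (ω² (1/r - r))`, where `r < 1` solves `r + 1/r = 2 +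
ν²`. This gives `T² ω² r / 2` (`tendsto_integral_bulkCurrent_sq`), and integrating `exp(-lam t)`
yields `κ = ω² r / (2 lam)`. -/

namespace HarmonicChain

noncomputable section

/-! ### Coordinates as continuous linear functionals -/

/-- The functional `X ↦ q_k`. -/
def posL (N : ℕ) : ℕ → Phase N →L[ℝ] ℝ
  | 0 => 0
  | k + 1 => if h : k < N then ContinuousLinearMap.proj (Sum.inl ⟨k, h⟩) else 0

/-- The functional `X ↦ p_k`. -/
def momL (N : ℕ) : ℕ → Phase N →L[ℝ] ℝ
  | 0 => 0
  | k + 1 => if h : k < N then ContinuousLinearMap.proj (Sum.inr ⟨k, h⟩) else 0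

variable {N : ℕ}

lemma posL_apply (k : ℕ) (X : Phase N) : posL N k X = pos X k := by
  cases k with
  | zero => simp [posL, pos, entry]
  | succ k => by_cases h : k < N <;> simp [posL, pos, entry, h]

lemma momL_apply (k : ℕ) (X : Phase N) : momL N k X = mom X k := by
  cases k with
  | zero => simp [momL, mom, entry]
  | succ k => by_cases h : k < N <;> simp [momL, mom, entry, h]

lemma pos_fin (X : Phase N) (i : Fin N) : pos X (i + 1) = X (Sum.inl i) := by
  simp [pos, entry]

lemma mom_fin (X : Phase N) (i : Fin N) : mom X (i + 1) = X (Sum.inr i) := by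
  simp [mom, entry]

@[simp] lemma pos_zero (X : Phase N) : pos X 0 = 0 := rfl

@[simp] lemma mom_zero (X : Phase N) : mom X 0 = 0 := rfl

lemma pos_of_lt (X : Phase N) {k : ℕ} (h : N < k) : pos X k = 0 := by
  cases k with
  | zero => rfl
  | succ k => simp [pos, entry]; omega

lemma mom_of_lt (X : Phase N) {k : ℕ} (h : N < k) : mom X k = 0 := by
  cases k with
  | zero => rfl
  | succ k => simp [mom, entry]; omega

lemma pos_add (X Y : Phase N) (k : ℕ) : pos (X + Y) k = pos X k + pos Y k := by
  simp [← posL_apply]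

lemma pos_smul (c : ℝ) (X : Phase N) (k : ℕ) : pos (c • X) k = c * pos X k := by
  simp [← posL_apply]

lemma mom_add (X Y : Phase N) (k : ℕ) : mom (X + Y) k = mom X k + mom Y k := by
  simp [← momL_apply]

lemma mom_smul (c : ℝ) (X : Phase N) (k : ℕ) : mom (c • X) k = c * mom X k := by
  simp [← momL_apply]

lemma sum_site (f : Site N → ℝ) (g h : ℕ → ℝ) (hg : ∀ i : Fin N, f (Sum.inl i) = g i)
    (hh : ∀ i : Fin N, f (Sum.inr i) = h i) :
    ∑ a, f a = ∑ k ∈ Finset.range N, (g k + h k) := by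
  rw [Fintype.sum_sum_type, Finset.sum_add_distrib, Finset.sum_range, Finset.sum_range]
  simp [hg, hh]

/-- The squared Euclidean norm on phase space. -/
def normSq (X : Phase N) : ℝ := ∑ a, X a ^ 2

lemma normSq_eq (X : Phase N) :
    normSq X = ∑ k ∈ Finset.range N, (pos X (k + 1) ^ 2 + mom X (k + 1) ^ 2) :=
  sum_site _ _ _ (fun i => by rw [pos_fin]) (fun i => by rw [mom_fin])

lemma normSq_nonneg (X : Phase N) : 0 ≤ normSq X := Finset.sum_nonneg fun _ _ => sq_nonneg _

lemma sq_le_normSq (X : Phase N) (a : Site N) : X a ^ 2 ≤ normSq X :=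
  Finset.single_le_sum (f := fun a => X a ^ 2) (fun _ _ => sq_nonneg _) (Finset.mem_univ a)

lemma norm_sq_le_normSq (X : Phase N) : ‖X‖ ^ 2 ≤ normSq X := by
  have h : ‖X‖ ≤ √(normSq X) := by
    refine (pi_norm_le_iff_of_nonneg (Real.sqrt_nonneg _)).2 fun a => ?_
    rw [Real.norm_eq_abs, ← Real.sqrt_sq_eq_abs]
    exact Real.sqrt_le_sqrt (sq_le_normSq X a)
  calc ‖X‖ ^ 2 ≤ √(normSq X) ^ 2 := by gcongr
    _ = normSq X := Real.sq_sqrt (normSq_nonneg X)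

/-! ### The energy form -/

/-- The `k + 1`-st component of `Φ q`. -/
def force (ω γ : ℝ) (X : Phase N) (k : ℕ) : ℝ :=
  ω ^ 2 * (2 * pos X (k + 1) - pos X (k + 2) - pos X k) + γ ^ 2 * pos X (k + 1)

/-- The symmetric bilinear form whose quadratic form is `2 H`. -/
def energyForm (ω γ : ℝ) (X Y : Phase N) : ℝ :=
  ∑ k ∈ Finset.range N, (mom X (k + 1) * mom Y (k + 1) + force ω γ X k * pos Y (k + 1))

/-- Discrete Green identity; with Dirichlet values its boundary terms vanish, which turns the force
pairing into a manifestly symmetric form. -/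
lemma sum_by_parts (a b : ℕ → ℝ) (M : ℕ) :
    ∑ k ∈ Finset.range (M + 1), (a (k + 1) - a k) * (b (k + 1) - b k) =
      ∑ k ∈ Finset.range M, (2 * a (k + 1) - a (k + 2) - a k) * b (k + 1) +
        (a (M + 1) - a M) * b (M + 1) - (a 1 - a 0) * b 0 := by
  induction M with
  | zero => simp; ring
  | succ M ih => rw [Finset.sum_range_succ, ih, Finset.sum_range_succ _ M]; ring

lemma sum_force_mul_pos (ω γ : ℝ) (X Y : Phase N) :
    ∑ k ∈ Finset.range N, force ω γ X k * pos Y (k + 1) =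
      γ ^ 2 * ∑ k ∈ Finset.range N, pos X (k + 1) * pos Y (k + 1) +
      ω ^ 2 * ∑ k ∈ Finset.range (N + 1),
        (pos X (k + 1) - pos X k) * (pos Y (k + 1) - pos Y k) := by
  rw [sum_by_parts, pos_of_lt Y (Nat.lt_succ_self N), pos_zero Y, mul_zero, mul_zero, add_zero,
    sub_zero, Finset.mul_sum, Finset.mul_sum, ← Finset.sum_add_distrib]
  refine Finset.sum_congr rfl fun k _ => ?_
  rw [force]; ring

lemma energyForm_eq (ω γ : ℝ) (X Y : Phase N) :
    energyForm ω γ X Y = ∑ k ∈ Finset.range N, mom X (k + 1) * mom Y (k + 1) +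
      (γ ^ 2 * ∑ k ∈ Finset.range N, pos X (k + 1) * pos Y (k + 1) +
      ω ^ 2 * ∑ k ∈ Finset.range (N + 1),
        (pos X (k + 1) - pos X k) * (pos Y (k + 1) - pos Y k)) := by
  rw [energyForm, Finset.sum_add_distrib, sum_force_mul_pos]

lemma energyForm_comm (ω γ : ℝ) (X Y : Phase N) : energyForm ω γ X Y = energyForm ω γ Y X := by
  simp only [energyForm_eq, mul_comm]

lemma hamiltonian_eq (ω γ : ℝ) (X : Phase N) :
    hamiltonian ω γ X = energyForm ω γ X X / 2 := by
  rw [energyForm_eq, hamiltonian]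
  have h (f : ℕ → ℝ) (M : ℕ) : ∑ i ∈ Finset.Icc 1 M, f i = ∑ k ∈ Finset.range M, f (k + 1) := by
    rw [Finset.range_eq_Ico, Finset.sum_Ico_add' f 0 M 1]; rfl
  rw [h, h, Finset.sum_add_distrib, Finset.mul_sum, Finset.mul_sum, add_div, add_div,
    Finset.sum_div, Finset.sum_div, Finset.sum_div, add_assoc]
  congr 1
  · exact Finset.sum_congr rfl fun k _ => by ring
  congr 1
  · exact Finset.sum_congr rfl fun k _ => by rw [onSite]; ring
  · exact Finset.sum_congr rfl fun k _ => by rw [bond, Nat.add_sub_cancel]; ring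

lemma energyForm_add_smul_left (ω γ t : ℝ) (X V Y : Phase N) :
    energyForm ω γ (X + t • V) Y = energyForm ω γ X Y + t * energyForm ω γ V Y := by
  simp only [energyForm, force, Finset.mul_sum, ← Finset.sum_add_distrib, pos_add, pos_smul,
    mom_add, mom_smul]
  exact Finset.sum_congr rfl fun k _ => by ring

/-- Exact second-order Taylor expansion; the linear coefficient is the directional derivative needed
for integration by parts. -/
lemma hamiltonian_add_smul (ω γ t : ℝ) (X V : Phase N) :
    hamiltonian ω γ (X + t • V) =
      hamiltonian ω γ X + t * energyForm ω γ X V + t ^ 2 * hamiltonian ω γ V := by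
  simp only [hamiltonian_eq]
  rw [energyForm_add_smul_left, energyForm_comm ω γ X, energyForm_comm ω γ V,
    energyForm_add_smul_left, energyForm_add_smul_left, energyForm_comm ω γ V X]
  ring

lemma hamiltonian_neg (ω γ : ℝ) (X : Phase N) : hamiltonian ω γ (-X) = hamiltonian ω γ X := by
  have h : -X = X + (-2 : ℝ) • X := by ext; simp; ring
  rw [h, hamiltonian_add_smul, hamiltonian_eq]; ring

/-- Discard the bond energy: the pinning and kinetic terms alone are coercive. This is the source of
uniformity in `N`, since the unpinned chain has no spectral gap bounded below in `N`. -/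
lemma le_energyForm_self (ω γ : ℝ) (X : Phase N) :
    min 1 (γ ^ 2) * normSq X ≤ energyForm ω γ X X := by
  rw [energyForm_eq, normSq_eq, Finset.sum_add_distrib, mul_add]
  have h1 : 0 ≤ ∑ k ∈ Finset.range N, pos X (k + 1) ^ 2 := Finset.sum_nonneg fun _ _ => sq_nonneg _
  have h2 : 0 ≤ ∑ k ∈ Finset.range N, mom X (k + 1) ^ 2 := Finset.sum_nonneg fun _ _ => sq_nonneg _
  have h3 : 0 ≤ ω ^ 2 * ∑ k ∈ Finset.range (N + 1), (pos X (k + 1) - pos X k) ^ 2 :=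
    mul_nonneg (sq_nonneg _) (Finset.sum_nonneg fun _ _ => sq_nonneg _)
  have h4 := mul_le_mul_of_nonneg_right (min_le_right 1 (γ ^ 2)) h1
  have h5 := mul_le_mul_of_nonneg_right (min_le_left 1 (γ ^ 2)) h2
  simp only [← sq]
  linarith

lemma sum_pos_sq_shift_le (X : Phase N) :
    ∑ k ∈ Finset.range (N + 1), (pos X (k + 1) - pos X k) ^ 2 ≤
      4 * ∑ k ∈ Finset.range N, pos X (k + 1) ^ 2 := by
  have h1 : ∑ k ∈ Finset.range (N + 1), pos X (k + 1) ^ 2 =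
      ∑ k ∈ Finset.range N, pos X (k + 1) ^ 2 := by
    rw [Finset.sum_range_succ, pos_of_lt X (Nat.lt_succ_self N)]; simp
  have h2 : ∑ k ∈ Finset.range (N + 1), pos X k ^ 2 =
      ∑ k ∈ Finset.range N, pos X (k + 1) ^ 2 := by
    rw [Finset.sum_range_succ']; simp
  calc _ ≤ ∑ k ∈ Finset.range (N + 1), (2 * pos X (k + 1) ^ 2 + 2 * pos X k ^ 2) :=
        Finset.sum_le_sum fun k _ => by nlinarith [sq_nonneg (pos X (k + 1) + pos X k)]
    _ = _ := by rw [Finset.sum_add_distrib, ← Finset.mul_sum, ← Finset.mul_sum, h1, h2]; ring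

lemma energyForm_self_le (ω γ : ℝ) (X : Phase N) :
    energyForm ω γ X X ≤ (1 + γ ^ 2 + 4 * ω ^ 2) * normSq X := by
  rw [energyForm_eq, normSq_eq, Finset.sum_add_distrib]
  have h1 : 0 ≤ ∑ k ∈ Finset.range N, pos X (k + 1) ^ 2 := Finset.sum_nonneg fun _ _ => sq_nonneg _
  have h2 : 0 ≤ ∑ k ∈ Finset.range N, mom X (k + 1) ^ 2 := Finset.sum_nonneg fun _ _ => sq_nonneg _
  have h3 := mul_le_mul_of_nonneg_left (sum_pos_sq_shift_le X) (sq_nonneg ω)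
  simp only [← sq]
  nlinarith [mul_nonneg (sq_nonneg γ) h2, mul_nonneg (sq_nonneg ω) h2]

/-! ### The drift -/

lemma forceMatrix_mulVec (ω γ : ℝ) (hω : ω ≠ 0) (X : Phase N) (i : Fin N) :
    (forceMatrix ω γ N *ᵥ fun j => X (Sum.inl j)) i = force ω γ X i := by
  have h : ∀ j : Fin N, forceMatrix ω γ N i j =
      (2 * ω ^ 2 + γ ^ 2) * (if i = j then 1 else 0) -
        ω ^ 2 * (if (i : ℕ) + 1 = j then 1 else 0) - ω ^ 2 * (if (j : ℕ) + 1 = i then 1 else 0) := by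
    intro j
    simp only [forceMatrix, laplacian, Matrix.smul_apply, Matrix.add_apply, Matrix.neg_apply,
      Matrix.of_apply, Matrix.one_apply, smul_eq_mul]
    by_cases h1 : i = j
    · subst h1; simp; field_simp
    · by_cases h2 : (i : ℕ) + 1 = j
      · have h3 : ¬ (j : ℕ) + 1 = i := by omega
        simp [h1, h2, h3]
      · by_cases h3 : (j : ℕ) + 1 = i <;> simp [h1, h2, h3]
  have hs : ∑ j : Fin N, (if i = j then (1 : ℝ) else 0) * X (Sum.inl j) = pos X (i + 1) := by
    simp [pos_fin]
  have hr : ∑ j : Fin N, (if (i : ℕ) + 1 = j then (1 : ℝ) else 0) * X (Sum.inl j) =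
      pos X (i + 2) := by
    by_cases hi : (i : ℕ) + 1 < N
    · rw [Finset.sum_eq_single ⟨i + 1, hi⟩]
      · simp [← pos_fin]
      · intro b _ hb
        have : ¬ (i : ℕ) + 1 = b := fun h => hb (Fin.ext h.symm)
        simp [this]
      · simp
    · rw [pos_of_lt X (by omega)]
      refine Finset.sum_eq_zero fun j _ => ?_
      have : ¬ (i : ℕ) + 1 = j := by omega
      simp [this]
  have hl : ∑ j : Fin N, (if (j : ℕ) + 1 = i then (1 : ℝ) else 0) * X (Sum.inl j) =
      pos X i := by
    obtain ⟨k, hk⟩ := i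
    cases k with
    | zero => simp
    | succ k =>
      rw [Finset.sum_eq_single ⟨k, by omega⟩]
      · simp [← pos_fin]
      · intro b _ hb
        have : ¬ (b : ℕ) = k := fun h => hb (Fin.ext h)
        simp [this]
      · simp
  rw [force, ← hs, ← hr, ← hl]
  simp only [Matrix.mulVec, dotProduct, h, Finset.mul_sum, ← Finset.sum_sub_distrib,
    ← Finset.sum_add_distrib]
  exact Finset.sum_congr rfl fun j _ => by ring

/-- The drift matrix as a continuous linear map. -/
def driftL (ω γ lam : ℝ) (N : ℕ) : Phase N →L[ℝ] Phase N :=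
  (Matrix.mulVecLin (driftMatrix ω γ lam N)).toContinuousLinearMap

lemma driftL_apply (ω γ lam : ℝ) (X : Phase N) :
    driftL ω γ lam N X = driftMatrix ω γ lam N *ᵥ X := rfl

lemma driftL_inl (ω γ lam : ℝ) (X : Phase N) (i : Fin N) :
    driftL ω γ lam N X (Sum.inl i) = -X (Sum.inr i) := by
  rw [driftL_apply, driftMatrix, Matrix.fromBlocks_mulVec]
  simp [Matrix.neg_mulVec, Function.comp_def]

lemma driftL_inr (ω γ lam : ℝ) (hω : ω ≠ 0) (X : Phase N) (i : Fin N) :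
    driftL ω γ lam N X (Sum.inr i) = force ω γ X i + lam * X (Sum.inr i) := by
  rw [driftL_apply, driftMatrix, Matrix.fromBlocks_mulVec]
  simp only [Sum.elim_inr, Pi.add_apply, Matrix.smul_mulVec, Matrix.one_mulVec, Pi.smul_apply,
    smul_eq_mul, Function.comp_def]
  rw [← forceMatrix_mulVec ω γ hω]

lemma pos_driftL (ω γ lam : ℝ) (X : Phase N) (k : ℕ) :
    pos (driftL ω γ lam N X) k = -mom X k := by
  rcases k with _ | k
  · simp
  by_cases h : k < N
  · rw [pos_fin _ ⟨k, h⟩, mom_fin _ ⟨k, h⟩, driftL_inl]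
  · rw [pos_of_lt _ (by omega), mom_of_lt _ (by omega), neg_zero]

lemma mom_driftL (ω γ lam : ℝ) (hω : ω ≠ 0) (X : Phase N) {k : ℕ} (h : k < N) :
    mom (driftL ω γ lam N X) (k + 1) = force ω γ X k + lam * mom X (k + 1) := by
  rw [mom_fin _ ⟨k, h⟩, mom_fin _ ⟨k, h⟩, driftL_inr _ _ _ hω]

/-! ### The deterministic flow -/

/-- The flow `exp (-t A)` of the equation `X' = -A X`. -/
def flow (ω γ lam : ℝ) (N : ℕ) (t : ℝ) : Phase N →L[ℝ] Phase N :=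
  NormedSpace.exp (t • (-driftL ω γ lam N))

lemma flow_zero (ω γ lam : ℝ) (X : Phase N) : flow ω γ lam N 0 X = X := by
  simp [flow]

lemma flow_driftL (ω γ lam t : ℝ) (X : Phase N) :
    flow ω γ lam N t (driftL ω γ lam N X) = driftL ω γ lam N (flow ω γ lam N t X) := by
  have h := (hasDerivAt_exp_smul_const (-driftL ω γ lam N) t).unique
    (hasDerivAt_exp_smul_const' (-driftL ω γ lam N) t)
  simpa [flow] using congrArg (fun L : Phase N →L[ℝ] Phase N => L X) h

lemma hasDerivAt_flow (ω γ lam t : ℝ) :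
    HasDerivAt (flow ω γ lam N) (-(driftL ω γ lam N) * flow ω γ lam N t) t :=
  hasDerivAt_exp_smul_const' (-driftL ω γ lam N) t

lemma hasDerivAt_flow_apply (ω γ lam t : ℝ) (X : Phase N) :
    HasDerivAt (fun s => flow ω γ lam N s X) (-(driftL ω γ lam N (flow ω γ lam N t X))) t := by
  simpa using (hasDerivAt_flow ω γ lam t).clm_apply (hasDerivAt_const t X)

lemma continuous_flow (ω γ lam : ℝ) : Continuous (flow ω γ lam N) :=
  continuous_iff_continuousAt.2 fun t => (hasDerivAt_flow ω γ lam t).continuousAt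

/-! ### Exponential decay -/

/-- A Lyapunov function of the flow. -/
def lyapunov (ω γ lam : ℝ) (X : Phase N) : ℝ :=
  energyForm ω γ X X / 2 + lam / 2 * ∑ k ∈ Finset.range N, pos X (k + 1) * mom X (k + 1) +
    lam ^ 2 / 4 * ∑ k ∈ Finset.range N, pos X (k + 1) ^ 2

/-- Completing the square, the two added terms cost at most a quarter of `∑ p²`, hence at most half
of the leading term. -/
lemma energyForm_le_lyapunov (ω γ lam : ℝ) (X : Phase N) :
    energyForm ω γ X X / 4 ≤ lyapunov ω γ lam X := by
  have h1 : 0 ≤ ∑ k ∈ Finset.range N, (lam / 2 * pos X (k + 1) + mom X (k + 1) / 2) ^ 2 :=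
    Finset.sum_nonneg fun _ _ => sq_nonneg _
  have h2 : ∑ k ∈ Finset.range N, (lam / 2 * pos X (k + 1) + mom X (k + 1) / 2) ^ 2 =
      lam / 2 * ∑ k ∈ Finset.range N, pos X (k + 1) * mom X (k + 1) +
      lam ^ 2 / 4 * ∑ k ∈ Finset.range N, pos X (k + 1) ^ 2 +
      (∑ k ∈ Finset.range N, mom X (k + 1) * mom X (k + 1)) / 4 := by
    rw [Finset.mul_sum, Finset.mul_sum, Finset.sum_div, ← Finset.sum_add_distrib,
      ← Finset.sum_add_distrib]
    exact Finset.sum_congr rfl fun k _ => by ring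
  have h3 : ∑ k ∈ Finset.range N, mom X (k + 1) * mom X (k + 1) ≤ energyForm ω γ X X := by
    rw [energyForm_eq]
    have := mul_nonneg (sq_nonneg γ)
      (Finset.sum_nonneg fun (k : ℕ) (_ : k ∈ Finset.range N) => mul_self_nonneg (pos X (k + 1)))
    have := mul_nonneg (sq_nonneg ω)
      (Finset.sum_nonneg fun (k : ℕ) (_ : k ∈ Finset.range (N + 1)) =>
        mul_self_nonneg (pos X (k + 1) - pos X k))
    linarith
  rw [lyapunov]
  linarith

/-- The constant in the upper bound of the Lyapunov function by the energy. -/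
def lyapunovConst (γ lam : ℝ) : ℝ := 3 / 4 + lam ^ 2 / (2 * γ ^ 2)

lemma lyapunov_le_energyForm (ω γ lam : ℝ) (hγ : 0 < γ) (X : Phase N) :
    lyapunov ω γ lam X ≤ lyapunovConst γ lam * energyForm ω γ X X := by
  set P := ∑ k ∈ Finset.range N, mom X (k + 1) * mom X (k + 1) with hP
  set Q := ∑ k ∈ Finset.range N, pos X (k + 1) ^ 2 with hQ
  have hP0 : 0 ≤ P := Finset.sum_nonneg fun _ _ => mul_self_nonneg _
  have hQ0 : 0 ≤ Q := Finset.sum_nonneg fun _ _ => sq_nonneg _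
  -- Young's inequality; together with the third term of the Lyapunov function this produces `lam²/2
  -- ∑ q²`, which the pinning energy controls.
  have h1 : lam / 2 * ∑ k ∈ Finset.range N, pos X (k + 1) * mom X (k + 1) ≤
      lam ^ 2 / 4 * Q + P / 4 := by
    rw [hP, hQ, Finset.mul_sum, Finset.mul_sum, Finset.sum_div, ← Finset.sum_add_distrib]
    exact Finset.sum_le_sum fun k _ => by
      nlinarith [sq_nonneg (lam / 2 * pos X (k + 1) - mom X (k + 1) / 2)]
  have h2 : P + γ ^ 2 * Q ≤ energyForm ω γ X X := by
    rw [energyForm_eq]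
    have := mul_nonneg (sq_nonneg ω)
      (Finset.sum_nonneg fun (k : ℕ) (_ : k ∈ Finset.range (N + 1)) =>
        mul_self_nonneg (pos X (k + 1) - pos X k))
    simp only [hQ, sq] at this ⊢
    linarith
  have h3 : lam ^ 2 / 2 * Q = lam ^ 2 / (2 * γ ^ 2) * (γ ^ 2 * Q) := by field_simp
  have h4 : 0 ≤ lam ^ 2 / (2 * γ ^ 2) := by positivity
  have h5 : lam ^ 2 / (2 * γ ^ 2) * (γ ^ 2 * Q) ≤ lam ^ 2 / (2 * γ ^ 2) * energyForm ω γ X X :=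
    mul_le_mul_of_nonneg_left (by linarith) h4
  have h6 : 0 ≤ γ ^ 2 * Q := by positivity
  rw [lyapunov, lyapunovConst]
  linarith

lemma hasDerivAt_pos {y : ℝ → Phase N} {y' : Phase N} {t : ℝ} (h : HasDerivAt y y' t) (k : ℕ) :
    HasDerivAt (fun s => pos (y s) k) (pos y' k) t := by
  simp only [← posL_apply]
  exact (posL N k).hasFDerivAt.comp_hasDerivAt t h

lemma hasDerivAt_mom {y : ℝ → Phase N} {y' : Phase N} {t : ℝ} (h : HasDerivAt y y' t) (k : ℕ) :
    HasDerivAt (fun s => mom (y s) k) (mom y' k) t := by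
  simp only [← momL_apply]
  exact (momL N k).hasFDerivAt.comp_hasDerivAt t h

lemma pos_neg (X : Phase N) (k : ℕ) : pos (-X) k = -pos X k := by simp [← posL_apply]

lemma mom_neg (X : Phase N) (k : ℕ) : mom (-X) k = -mom X k := by simp [← momL_apply]

lemma hasDerivAt_energyForm {y : ℝ → Phase N} {y' : Phase N} {t : ℝ} (ω γ : ℝ)
    (h : HasDerivAt y y' t) :
    HasDerivAt (fun s => energyForm ω γ (y s) (y s)) (2 * energyForm ω γ (y t) y') t := by
  simp only [energyForm_eq]
  have hp := HasDerivAt.fun_sum fun k (_ : k ∈ Finset.range N) =>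
    (hasDerivAt_mom h (k + 1)).mul (hasDerivAt_mom h (k + 1))
  have hq := HasDerivAt.fun_sum fun k (_ : k ∈ Finset.range N) =>
    (hasDerivAt_pos h (k + 1)).mul (hasDerivAt_pos h (k + 1))
  have hd := HasDerivAt.fun_sum fun k (_ : k ∈ Finset.range (N + 1)) =>
    ((hasDerivAt_pos h (k + 1)).sub (hasDerivAt_pos h k)).mul
      ((hasDerivAt_pos h (k + 1)).sub (hasDerivAt_pos h k))
  refine (hp.add ((hq.const_mul (γ ^ 2)).add (hd.const_mul (ω ^ 2)))).congr_deriv ?_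
  simp only [mul_add, Finset.mul_sum]
  refine congrArg₂ _ ?_ (congrArg₂ _ ?_ ?_) <;>
  exact Finset.sum_congr rfl fun k _ => by (try simp only [Pi.sub_apply]); ring

lemma energyForm_neg_driftL (ω γ lam : ℝ) (hω : ω ≠ 0) (X : Phase N) :
    energyForm ω γ X (-(driftL ω γ lam N X)) =
      -lam * ∑ k ∈ Finset.range N, mom X (k + 1) ^ 2 := by
  rw [energyForm, Finset.mul_sum]
  refine Finset.sum_congr rfl fun k hk => ?_
  rw [pos_neg, mom_neg, pos_driftL, mom_driftL ω γ lam hω X (Finset.mem_range.1 hk)]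
  ring

/-- The energy alone dissipates only through the momenta. The cross term `q p` trades half of this
for dissipation in the positions, and the `lam²/4 q²` term cancels the leftover `q p`, so that the
whole energy form is dissipated. -/
lemma hasDerivAt_lyapunov {y : ℝ → Phase N} {t : ℝ} (ω γ lam : ℝ) (hω : ω ≠ 0)
    (h : HasDerivAt y (-(driftL ω γ lam N (y t))) t) :
    HasDerivAt (fun s => lyapunov ω γ lam (y s)) (-(lam / 2) * energyForm ω γ (y t) (y t)) t := by
  have hE := hasDerivAt_energyForm ω γ h
  have hqp := HasDerivAt.fun_sum fun k (_ : k ∈ Finset.range N) =>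
    (hasDerivAt_pos h (k + 1)).mul (hasDerivAt_mom h (k + 1))
  have hq := HasDerivAt.fun_sum fun k (_ : k ∈ Finset.range N) =>
    (hasDerivAt_pos h (k + 1)).pow 2
  refine (((hE.div_const 2).add (hqp.const_mul (lam / 2))).add
    (hq.const_mul (lam ^ 2 / 4))).congr_deriv ?_
  rw [energyForm_neg_driftL ω γ lam hω, energyForm]
  simp only [Finset.mul_sum, Finset.sum_div, ← Finset.sum_add_distrib]
  refine Finset.sum_congr rfl fun k hk => ?_
  rw [pos_neg, mom_neg, pos_driftL, mom_driftL ω γ lam hω _ (Finset.mem_range.1 hk)]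
  simp
  ring

/-- The rate of exponential decay of the flow. -/
def decayRate (γ lam : ℝ) : ℝ := lam / 2 / lyapunovConst γ lam

lemma lyapunovConst_pos (γ lam : ℝ) : 0 < lyapunovConst γ lam := by
  rw [lyapunovConst]; positivity

lemma decayRate_pos (γ : ℝ) {lam : ℝ} (hlam : 0 < lam) : 0 < decayRate γ lam :=
  div_pos (by positivity) (lyapunovConst_pos γ lam)

/-- Needed when the decay of the boundary terms is convolved with `exp(-lam t)`: the slower of the
two rates is the one that survives. -/
lemma decayRate_le (γ : ℝ) {lam : ℝ} (hlam : 0 < lam) : decayRate γ lam ≤ lam := by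
  rw [decayRate, div_le_iff₀ (lyapunovConst_pos γ lam), lyapunovConst]
  have : 0 ≤ lam * (lam ^ 2 / (2 * γ ^ 2)) := by positivity
  linarith

/-- Grönwall in the form that `exp(c s)` times the Lyapunov function is nonincreasing. -/
lemma lyapunov_flow_le (ω γ lam : ℝ) (hω : ω ≠ 0) (hγ : 0 < γ) (hlam : 0 < lam) (X : Phase N)
    {t : ℝ} (ht : 0 ≤ t) :
    lyapunov ω γ lam (flow ω γ lam N t X) ≤
      Real.exp (-decayRate γ lam * t) * lyapunov ω γ lam X := by
  set c := decayRate γ lam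
  have hd (s : ℝ) : HasDerivAt
      (fun s => Real.exp (c * s) * lyapunov ω γ lam (flow ω γ lam N s X))
      (Real.exp (c * s) * (c * lyapunov ω γ lam (flow ω γ lam N s X) +
        -(lam / 2) * energyForm ω γ (flow ω γ lam N s X) (flow ω γ lam N s X))) s := by
    refine ((((hasDerivAt_id s).const_mul c).exp).mul
      (hasDerivAt_lyapunov ω γ lam hω (hasDerivAt_flow_apply ω γ lam s X))).congr_deriv ?_
    simp; ring
  have ha : Antitone fun s => Real.exp (c * s) * lyapunov ω γ lam (flow ω γ lam N s X) := by
    refine antitone_of_deriv_nonpos (fun s => (hd s).differentiableAt) fun s => ?_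
    rw [(hd s).deriv]
    refine mul_nonpos_of_nonneg_of_nonpos (Real.exp_pos _).le ?_
    have h1 := mul_le_mul_of_nonneg_left
      (lyapunov_le_energyForm ω γ lam hγ (flow ω γ lam N s X)) (decayRate_pos γ hlam).le
    have h2 : decayRate γ lam * lyapunovConst γ lam = lam / 2 :=
      div_mul_cancel₀ _ (lyapunovConst_pos γ lam).ne'
    rw [← mul_assoc, h2] at h1
    simp only [c]
    linarith
  have h := ha ht
  simp only [mul_zero, Real.exp_zero, one_mul, flow_zero] at h
  calc lyapunov ω γ lam (flow ω γ lam N t X)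
      = Real.exp (-c * t) * (Real.exp (c * t) * lyapunov ω γ lam (flow ω γ lam N t X)) := by
        rw [← mul_assoc, ← Real.exp_add]; simp
    _ ≤ _ := mul_le_mul_of_nonneg_left h (Real.exp_pos _).le

/-- The prefactor in the exponential decay of the flow. -/
def decayConst (ω γ lam : ℝ) : ℝ :=
  4 / min 1 (γ ^ 2) * (lyapunovConst γ lam * (1 + γ ^ 2 + 4 * ω ^ 2))

lemma decayConst_pos (ω lam : ℝ) {γ : ℝ} (hγ : 0 < γ) : 0 < decayConst ω γ lam := by
  have := lyapunovConst_pos γ lam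
  have : 0 < min 1 (γ ^ 2) := lt_min one_pos (by positivity)
  rw [decayConst]; positivity

lemma normSq_flow_le (ω γ lam : ℝ) (hω : ω ≠ 0) (hγ : 0 < γ) (hlam : 0 < lam) (X : Phase N)
    {t : ℝ} (ht : 0 ≤ t) :
    normSq (flow ω γ lam N t X) ≤
      decayConst ω γ lam * Real.exp (-decayRate γ lam * t) * normSq X := by
  have hm : 0 < min 1 (γ ^ 2) := lt_min one_pos (by positivity)
  have h1 := le_energyForm_self ω γ (flow ω γ lam N t X)
  have h2 := energyForm_le_lyapunov ω γ lam (flow ω γ lam N t X)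
  have h3 := lyapunov_flow_le ω γ lam hω hγ hlam X ht
  have h4 := mul_le_mul_of_nonneg_left (((lyapunov_le_energyForm ω γ lam hγ X).trans
    (mul_le_mul_of_nonneg_left (energyForm_self_le ω γ X) (lyapunovConst_pos γ lam).le)))
    (Real.exp_pos (-decayRate γ lam * t)).le
  calc normSq (flow ω γ lam N t X)
      = min 1 (γ ^ 2) * normSq (flow ω γ lam N t X) / min 1 (γ ^ 2) := by field_simp
    _ ≤ 4 * (Real.exp (-decayRate γ lam * t) *
        (lyapunovConst γ lam * ((1 + γ ^ 2 + 4 * ω ^ 2) * normSq X))) / min 1 (γ ^ 2) := by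
        exact div_le_div_of_nonneg_right (by linarith) hm.le
    _ = _ := by rw [decayConst]; ring

/-- The vector `v` with `v ⬝ X = (exp (-t A) X)_a`. -/
def flowRow (ω γ lam t : ℝ) (a : Site N) : Phase N :=
  fun b => flow ω γ lam N t (Pi.single b 1) a

lemma flow_apply_eq_sum (ω γ lam t : ℝ) (a : Site N) (X : Phase N) :
    flow ω γ lam N t X a = ∑ b, flowRow ω γ lam t a b * X b := by
  have h : X = ∑ b, X b • (Pi.single b (1 : ℝ) : Phase N) := by
    ext c; simp [Finset.sum_apply, Pi.single_apply]
  conv_lhs => rw [h]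
  simp [map_sum, Finset.sum_apply, flowRow, mul_comm]

/-- Passing from the operator bound to its transpose: apply the flow to its own row `v`, so that
`|v|²` is the `a`-th coordinate of the image of `v`. A single coordinate of the flow thereby has
coefficients of total size independent of `N`. -/
lemma normSq_flowRow_le (ω γ lam : ℝ) (hω : ω ≠ 0) (hγ : 0 < γ) (hlam : 0 < lam) (a : Site N)
    {t : ℝ} (ht : 0 ≤ t) :
    normSq (flowRow ω γ lam t a) ≤ decayConst ω γ lam * Real.exp (-decayRate γ lam * t) := by
  set v : Phase N := flowRow ω γ lam t a with hv
  have h1 : normSq v = flow ω γ lam N t v a := by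
    rw [flow_apply_eq_sum, normSq]; exact Finset.sum_congr rfl fun b _ => by rw [← hv]; ring
  have h2 : normSq v ^ 2 ≤
      decayConst ω γ lam * Real.exp (-decayRate γ lam * t) * normSq v := by
    calc normSq v ^ 2 = (flow ω γ lam N t v a) ^ 2 := by rw [← h1]
      _ ≤ normSq (flow ω γ lam N t v) := sq_le_normSq _ a
      _ ≤ _ := normSq_flow_le ω γ lam hω hγ hlam v ht
  rcases (normSq_nonneg v).eq_or_lt with h0 | h0
  · rw [← h0]; exact mul_nonneg (decayConst_pos ω lam hγ).le (Real.exp_pos _).le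
  · rw [sq] at h2; exact le_of_mul_le_mul_right h2 h0

/-! ### Functions of temperate growth are integrable for the Gibbs measure -/

-- Temperate growth is stable under sums, products and linear substitutions and implies
-- integrability against the Gibbs measure, so all later integrability conditions reduce to it.
@[fun_prop]
lemma hasTemperateGrowth_pos (k : ℕ) :
    Function.HasTemperateGrowth fun X : Phase N => pos X k := by
  simpa only [← posL_apply] using (posL N k).hasTemperateGrowth

@[fun_prop]
lemma hasTemperateGrowth_mom (k : ℕ) :
    Function.HasTemperateGrowth fun X : Phase N => mom X k := by
  simpa only [← momL_apply] using (momL N k).hasTemperateGrowth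

@[fun_prop]
lemma hasTemperateGrowth_eval (a : Site N) :
    Function.HasTemperateGrowth fun X : Phase N => X a :=
  (ContinuousLinearMap.proj (R := ℝ) (φ := fun _ : Site N => ℝ) a).hasTemperateGrowth

@[fun_prop]
lemma hasTemperateGrowth_energyForm (ω γ : ℝ) (V : Phase N) :
    Function.HasTemperateGrowth fun X : Phase N => energyForm ω γ X V := by
  unfold energyForm force
  fun_prop

lemma hasTemperateGrowth_hamiltonian (ω γ : ℝ) :
    Function.HasTemperateGrowth fun X : Phase N => hamiltonian ω γ X := by
  unfold hamiltonian onSite bond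
  simp only [div_eq_mul_inv]
  fun_prop

/-- From `x^n ≤ n! exp x` at `x = 1 + y` and completing the square in `y - a y²`. -/
lemma one_add_pow_mul_exp_le (n : ℕ) {a y : ℝ} (ha : 0 < a) (hy : 0 ≤ y) :
    (1 + y) ^ n * Real.exp (-a * y ^ 2) ≤ n.factorial * Real.exp (1 + 1 / (4 * a)) := by
  have h1 : (1 + y) ^ n ≤ n.factorial * Real.exp (1 + y) := by
    have := Real.pow_div_factorial_le_exp (1 + y) (by linarith) n
    rwa [div_le_iff₀ (by positivity), mul_comm] at this
  have h2 : 1 + y + -a * y ^ 2 ≤ 1 + 1 / (4 * a) := by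
    have : 1 / (4 * a) - (y - a * y ^ 2) = a * (y - 1 / (2 * a)) ^ 2 := by field_simp; ring
    have : 0 ≤ a * (y - 1 / (2 * a)) ^ 2 := by positivity
    linarith
  calc (1 + y) ^ n * Real.exp (-a * y ^ 2)
      ≤ n.factorial * Real.exp (1 + y) * Real.exp (-a * y ^ 2) := by gcongr
    _ = n.factorial * Real.exp (1 + y + -a * y ^ 2) := by rw [Real.exp_add (1 + y)]; ring
    _ ≤ _ := by gcongr

lemma integrable_exp_mul {ω γ T : ℝ} (hγ : 0 < γ) (hT : 0 < T) {f : Phase N → ℝ}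
    (hf : f.HasTemperateGrowth) :
    Integrable fun X : Phase N => Real.exp (-hamiltonian ω γ X / T) * f X := by
  obtain ⟨k, C, hC⟩ := hf.2 0
  simp only [norm_iteratedFDeriv_zero] at hC
  set m := min 1 (γ ^ 2)
  have hm : 0 < m := lt_min one_pos (by positivity)
  set a := m / (2 * T)
  have ha : 0 < a := by positivity
  -- The decay `(1 + ‖X‖)^(-d)` is integrable as soon as `d` exceeds the dimension; the Gaussian
  -- factor absorbs the `d` extra powers.
  set d := Module.finrank ℝ (Phase N) + 1 with hd
  have hH (X : Phase N) : -hamiltonian ω γ X / T ≤ -a * ‖X‖ ^ 2 := by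
    have h1 := le_energyForm_self ω γ X
    have h2 := mul_le_mul_of_nonneg_left (norm_sq_le_normSq X) hm.le
    rw [hamiltonian_eq, div_le_iff₀ hT]
    have : -a * ‖X‖ ^ 2 * T = -(m * ‖X‖ ^ 2) / 2 := by simp only [a]; field_simp
    rw [this]; linarith
  have hint : Integrable fun X : Phase N => (1 + ‖X‖) ^ (-(d : ℝ)) :=
    integrable_one_add_norm (by rw [hd]; push_cast; linarith)
  have hC0 : 0 ≤ C := by simpa using (norm_nonneg _).trans (hC 0)
  refine (hint.const_mul (C * ((k + d).factorial * Real.exp (1 + 1 / (4 * a))))).mono'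
    ?_ (Eventually.of_forall fun X => ?_)
  · have h1 := (hasTemperateGrowth_hamiltonian ω γ (N := N)).1.continuous
    have h2 := hf.1.continuous
    exact (by fun_prop : Continuous fun X : Phase N =>
      Real.exp (-hamiltonian ω γ X / T) * f X).aestronglyMeasurable
  · have hX : 0 < 1 + ‖X‖ := by positivity
    rw [norm_mul, Real.norm_of_nonneg (Real.exp_pos _).le, Real.rpow_neg hX.le,
      Real.rpow_natCast, ← div_eq_mul_inv, le_div_iff₀ (by positivity)]
    calc Real.exp (-hamiltonian ω γ X / T) * ‖f X‖ * (1 + ‖X‖) ^ d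
        ≤ Real.exp (-a * ‖X‖ ^ 2) * (C * (1 + ‖X‖) ^ k) * (1 + ‖X‖) ^ d := by
          gcongr
          · exact hH X
          · exact hC X
      _ = C * ((1 + ‖X‖) ^ (k + d) * Real.exp (-a * ‖X‖ ^ 2)) := by rw [pow_add]; ring
      _ ≤ _ := by
          exact mul_le_mul_of_nonneg_left (one_add_pow_mul_exp_le _ ha (norm_nonneg X)) hC0

lemma integrable_exp_hamiltonian {ω γ T : ℝ} (hγ : 0 < γ) (hT : 0 < T) :
    Integrable fun X : Phase N => Real.exp (-hamiltonian ω γ X / T) := by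
  simpa using integrable_exp_mul (ω := ω) hγ hT (Function.HasTemperateGrowth.const (E := Phase N) (1 : ℝ))

lemma isProbabilityMeasure_gibbs {ω γ T : ℝ} (hγ : 0 < γ) (hT : 0 < T) (N : ℕ) :
    IsProbabilityMeasure (gibbs ω γ T N) :=
  isProbabilityMeasure_tilted (integrable_exp_hamiltonian hγ hT)

lemma integrable_gibbs {ω γ T : ℝ} (hγ : 0 < γ) (hT : 0 < T) {f : Phase N → ℝ}
    (hf : f.HasTemperateGrowth) : Integrable f (gibbs ω γ T N) := by
  rw [gibbs, integrable_tilted_iff (integrable_exp_hamiltonian hγ hT)]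
  exact integrable_exp_mul hγ hT hf

lemma integral_gibbs (ω γ T : ℝ) (f : Phase N → ℝ) :
    ∫ X, f X ∂gibbs ω γ T N = (∫ X : Phase N, Real.exp (-hamiltonian ω γ X / T))⁻¹ *
      ∫ X : Phase N, Real.exp (-hamiltonian ω γ X / T) * f X := by
  rw [gibbs, integral_tilted, ← integral_const_mul]
  exact integral_congr_ae (Eventually.of_forall fun X => by simp only [smul_eq_mul]; ring)

lemma integral_gibbs_neg (ω γ T : ℝ) (f : Phase N → ℝ) :
    ∫ X, f (-X) ∂gibbs ω γ T N = ∫ X, f X ∂gibbs ω γ T N := by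
  rw [integral_gibbs, integral_gibbs ω γ T f,
    ← integral_neg_eq_self fun X : Phase N => Real.exp (-hamiltonian ω γ X / T) * f X]
  simp only [hamiltonian_neg]

lemma integral_gibbs_eq_zero_of_odd (ω γ T : ℝ) {f : Phase N → ℝ} (hf : ∀ X, f (-X) = -f X) :
    ∫ X, f X ∂gibbs ω γ T N = 0 := by
  have h := integral_gibbs_neg ω γ T f
  simp only [hf, integral_neg] at h
  linarith

/-! ### Integration by parts -/

lemma hasLineDerivAt_exp_hamiltonian (ω γ T : ℝ) (X V : Phase N) :
    HasLineDerivAt ℝ (fun Y : Phase N => Real.exp (-hamiltonian ω γ Y / T))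
      (Real.exp (-hamiltonian ω γ X / T) * (-energyForm ω γ X V / T)) X V := by
  unfold HasLineDerivAt
  simp only [hamiltonian_add_smul]
  have h := (((((hasDerivAt_id (0 : ℝ)).mul_const (energyForm ω γ X V)).const_add
    (hamiltonian ω γ X)).add (((hasDerivAt_id (0 : ℝ)).pow 2).mul_const
      (hamiltonian ω γ V))).neg.div_const T).exp
  refine h.congr_deriv ?_
  simp

/-- Gaussian integration by parts. All covariances and Wick pairings below come from it, without
diagonalizing or inverting the force matrix. -/
lemma integral_gibbs_by_parts {ω γ T : ℝ} (hγ : 0 < γ) (hT : 0 < T) {f f' : Phase N → ℝ}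
    (V : Phase N) (hf : f.HasTemperateGrowth) (hf' : f'.HasTemperateGrowth)
    (hd : ∀ X, HasLineDerivAt ℝ f (f' X) X V) :
    ∫ X, energyForm ω γ X V * f X ∂gibbs ω γ T N = T * ∫ X, f' X ∂gibbs ω γ T N := by
  have key := integral_bilinear_hasLineDerivAt_right_eq_neg_left_of_integrable
    (μ := (volume : Measure (Phase N))) (B := ContinuousLinearMap.mul ℝ ℝ) (v := V)
    (f := fun Y : Phase N => Real.exp (-hamiltonian ω γ Y / T))
    (f' := fun X => Real.exp (-hamiltonian ω γ X / T) * (-energyForm ω γ X V / T))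
    (g := f) (g' := f') ?_ ?_ ?_ (fun X _ => hasLineDerivAt_exp_hamiltonian ω γ T X V)
    (fun X _ => hd X)
  · simp only [ContinuousLinearMap.mul_apply'] at key
    rw [integral_gibbs, integral_gibbs, key, mul_left_comm]
    congr 1
    rw [← integral_neg, ← integral_const_mul]
    refine integral_congr_ae (Eventually.of_forall fun X => ?_)
    simp only
    field_simp
  · simp only [ContinuousLinearMap.mul_apply', mul_assoc, div_eq_mul_inv]
    exact integrable_exp_mul hγ hT (by fun_prop)
  · exact integrable_exp_mul hγ hT hf'
  · exact integrable_exp_mul hγ hT hf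

lemma _root_.ContinuousLinearMap.hasLineDerivAt_apply {E : Type*} [NormedAddCommGroup E]
    [NormedSpace ℝ E] (L : E →L[ℝ] ℝ) (x v : E) : HasLineDerivAt ℝ L (L v) x v :=
  L.hasFDerivAt.hasLineDerivAt v

lemma _root_.HasLineDerivAt.mul_real {E : Type*} [NormedAddCommGroup E] [NormedSpace ℝ E]
    {f g : E → ℝ} {f' g' : ℝ} {x v : E} (hf : HasLineDerivAt ℝ f f' x v)
    (hg : HasLineDerivAt ℝ g g' x v) :
    HasLineDerivAt ℝ (fun y => f y * g y) (f' * g x + f x * g') x v := by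
  have h := HasDerivAt.mul (𝕜 := ℝ) hf hg
  simp only [zero_smul, add_zero] at h
  exact h

lemma integral_energyForm_mul {ω γ T : ℝ} (hγ : 0 < γ) (hT : 0 < T) (V : Phase N)
    (L : Phase N →L[ℝ] ℝ) :
    ∫ X, energyForm ω γ X V * L X ∂gibbs ω γ T N = T * L V := by
  have := isProbabilityMeasure_gibbs (ω := ω) hγ hT N
  rw [integral_gibbs_by_parts hγ hT V L.hasTemperateGrowth (.const (L V))
    (fun X => L.hasLineDerivAt_apply X V)]
  simp

lemma integral_energyForm_mul_mul_mul {ω γ T : ℝ} (hγ : 0 < γ) (hT : 0 < T) (V : Phase N)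
    (L₁ L₂ L₃ : Phase N →L[ℝ] ℝ) :
    ∫ X, energyForm ω γ X V * (L₁ X * L₂ X * L₃ X) ∂gibbs ω γ T N =
      T * (L₁ V * ∫ X, L₂ X * L₃ X ∂gibbs ω γ T N + L₂ V * ∫ X, L₁ X * L₃ X ∂gibbs ω γ T N +
        L₃ V * ∫ X, L₁ X * L₂ X ∂gibbs ω γ T N) := by
  have t₁ := L₁.hasTemperateGrowth
  have t₂ := L₂.hasTemperateGrowth
  have t₃ := L₃.hasTemperateGrowth
  rw [integral_gibbs_by_parts hγ hT V (f' := fun X => L₁ V * (L₂ X * L₃ X) + L₂ V * (L₁ X * L₃ X) +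
      L₃ V * (L₁ X * L₂ X)) (by fun_prop) (by fun_prop)]
  · rw [integral_add (integrable_gibbs hγ hT (by fun_prop)) (integrable_gibbs hγ hT (by fun_prop)),
      integral_add (integrable_gibbs hγ hT (by fun_prop)) (integrable_gibbs hγ hT (by fun_prop)),
      integral_const_mul, integral_const_mul, integral_const_mul]
  · intro X
    have h := ((L₁.hasLineDerivAt_apply X V).mul_real (L₂.hasLineDerivAt_apply X V)).mul_real
      (L₃.hasLineDerivAt_apply X V)
    exact HasDerivAt.congr_deriv (𝕜 := ℝ) h (by ring)

/-! ### Moments of linear functionals -/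

/-- `X ↦ energyForm X V` as a continuous linear functional. -/
def energyL (ω γ : ℝ) (V : Phase N) : Phase N →L[ℝ] ℝ :=
  ∑ k ∈ Finset.range N, (mom V (k + 1) • momL N (k + 1) + pos V (k + 1) •
    (ω ^ 2 • (2 • posL N (k + 1) - posL N (k + 2) - posL N k) + γ ^ 2 • posL N (k + 1)))

lemma energyL_apply (ω γ : ℝ) (V X : Phase N) : energyL ω γ V X = energyForm ω γ X V := by
  simp only [energyL, energyForm, force, _root_.sum_apply,
    _root_.add_apply, _root_.smul_apply, _root_.sub_apply,
    posL_apply, momL_apply, smul_eq_mul, nsmul_eq_mul]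
  exact Finset.sum_congr rfl fun k _ => by push_cast; ring

/-- Riesz representation for the energy form. The representing vector is the covariance of `X` with
`L X`, by integration by parts against an arbitrary direction. -/
lemma exists_energyForm_eq {ω γ T : ℝ} (hγ : 0 < γ) (hT : 0 < T) (L : Phase N →L[ℝ] ℝ) :
    ∃ U : Phase N, ∀ X, energyForm ω γ X U = T * L X := by
  have t := L.hasTemperateGrowth
  refine ⟨∫ X, L X • X ∂gibbs ω γ T N, fun V => ?_⟩
  have hint : Integrable (fun X : Phase N => L X • X) (gibbs ω γ T N) := by
    refine Integrable.of_eval fun a => ?_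
    simp only [Pi.smul_apply, smul_eq_mul]
    exact integrable_gibbs hγ hT (by fun_prop)
  rw [energyForm_comm, ← energyL_apply, ← ContinuousLinearMap.integral_comp_comm _ hint,
    ← integral_energyForm_mul (ω := ω) hγ hT V L]
  refine integral_congr_ae (Eventually.of_forall fun X => ?_)
  simp [energyL_apply, mul_comm]

lemma sq_apply_le (L : Phase N →L[ℝ] ℝ) (X : Phase N) :
    L X ^ 2 ≤ normSq (fun a => L (Pi.single a 1)) * normSq X := by
  have h : X = ∑ b, X b • (Pi.single b (1 : ℝ) : Phase N) := by
    ext c; simp [Finset.sum_apply, Pi.single_apply]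
  have h2 : L X = ∑ a, L (Pi.single a 1) * X a := by
    conv_lhs => rw [h]
    simp [map_sum, mul_comm]
  rw [h2]
  exact Finset.sum_mul_sq_le_sq_mul_sq _ _ _

/-- With `U` representing `T L`, the variance of `L` is `L U`. Coercivity bounds `|U|²` by a
multiple of `L U`, and `(L U)²` is at most `|L|² |U|²`; one factor `L U` cancels. -/
lemma integral_sq_le {ω γ T : ℝ} (hγ : 0 < γ) (hT : 0 < T) (L : Phase N →L[ℝ] ℝ) :
    ∫ X, L X ^ 2 ∂gibbs ω γ T N ≤
      T / min 1 (γ ^ 2) * normSq (fun a => L (Pi.single a 1)) := by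
  obtain ⟨U, hU⟩ := exists_energyForm_eq (ω := ω) hγ hT L
  have hm : 0 < min 1 (γ ^ 2) := lt_min one_pos (by positivity)
  have h1 := integral_energyForm_mul (ω := ω) hγ hT U L
  simp only [hU, mul_assoc, integral_const_mul] at h1
  have h2 := mul_left_cancel₀ hT.ne' h1
  have h3 := le_energyForm_self ω γ U
  rw [hU] at h3
  have h4 := sq_apply_le L U
  simp only [sq] at h2 ⊢
  rw [h2]
  set v := normSq fun a => L (Pi.single a 1)
  have hv : 0 ≤ v := normSq_nonneg _
  rcases le_or_gt (L U) 0 with h0 | h0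
  · exact h0.trans (by rw [← sq]; positivity)
  · have h5 : min 1 (γ ^ 2) * (L U * L U) ≤ v * (T * L U) := by
      calc min 1 (γ ^ 2) * (L U * L U) ≤ min 1 (γ ^ 2) * (v * normSq U) := by
            rw [← sq (L U)]; gcongr
        _ = v * (min 1 (γ ^ 2) * normSq U) := by ring
        _ ≤ _ := by gcongr
    rw [← sq γ, div_mul_eq_mul_div, le_div_iff₀ hm]
    refine le_of_mul_le_mul_right ?_ h0
    linarith

/-- Wick's rule: there are three pairings of four equal factors. -/
lemma integral_pow_four {ω γ T : ℝ} (hγ : 0 < γ) (hT : 0 < T) (L : Phase N →L[ℝ] ℝ) :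
    ∫ X, L X ^ 4 ∂gibbs ω γ T N = 3 * (∫ X, L X ^ 2 ∂gibbs ω γ T N) ^ 2 := by
  obtain ⟨U, hU⟩ := exists_energyForm_eq (ω := ω) hγ hT L
  have h1 := integral_energyForm_mul (ω := ω) hγ hT U L
  have h2 := integral_energyForm_mul_mul_mul (ω := ω) hγ hT U L L L
  simp only [hU, mul_assoc, integral_const_mul] at h1 h2
  have h3 := mul_left_cancel₀ hT.ne' h1
  have h4 := mul_left_cancel₀ hT.ne' h2
  have h5 (X : Phase N) : L X ^ 4 = L X * (L X * (L X * L X)) := by ring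
  simp only [h5, h4, sq]
  rw [← h3]; ring

lemma integral_pow_four_le {ω γ T : ℝ} (hγ : 0 < γ) (hT : 0 < T) (L : Phase N →L[ℝ] ℝ) :
    ∫ X, L X ^ 4 ∂gibbs ω γ T N ≤
      3 * (T / min 1 (γ ^ 2) * normSq (fun a => L (Pi.single a 1))) ^ 2 := by
  rw [integral_pow_four hγ hT]
  have : 0 ≤ ∫ X, L X ^ 2 ∂gibbs ω γ T N := integral_nonneg fun _ => sq_nonneg _
  gcongr
  exact integral_sq_le hγ hT L

/-! ### The bulk part of the current -/

/-- The part `-(ω² / 2) ∑ (q_{k+1} - q_{k-1}) p_k` of the total current. -/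
def bulkCurrent (ω : ℝ) (X : Phase N) : ℝ :=
  -(ω ^ 2 / 2) * ∑ k ∈ Finset.range N, (pos X (k + 2) - pos X k) * mom X (k + 1)

/-- The boundary part `q_N p_N - q_1 p_1` of the current. -/
def edgeCurrent (X : Phase N) : ℝ := pos X N * mom X N - pos X 1 * mom X 1

lemma sum_current (a b : ℕ → ℝ) (M : ℕ) :
    ∑ i ∈ Finset.Ico 1 (M + 1), (a (i + 1) - a i) * (b i + b (i + 1)) =
      ∑ k ∈ Finset.range (M + 1), (a (k + 2) - a k) * b (k + 1) -
        (a (M + 2) - a (M + 1)) * b (M + 1) - (a 1 - a 0) * b 1 := by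
  induction M with
  | zero => simp; ring
  | succ M ih =>
    rw [Finset.sum_Ico_succ_top (by omega), ih, Finset.sum_range_succ _ (M + 1)]; ring

/-- Collecting the coefficient of each `p_k` gives `q_{k+1} - q_{k-1}`, except that the end
particles belong to one bond of the sum only. -/
lemma totalCurrent_eq (ω : ℝ) (X : Phase N) :
    totalCurrent ω X = bulkCurrent ω X - ω ^ 2 / 2 * edgeCurrent X := by
  rcases N with _ | M
  · simp [totalCurrent, bulkCurrent, edgeCurrent, pos_of_lt X one_pos]
  · have h := sum_current (pos X) (mom X) M
    rw [pos_of_lt X (show M + 1 < M + 2 by omega), pos_zero] at h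
    simp only [totalCurrent, localCurrent, bulkCurrent, edgeCurrent, mul_assoc, ← Finset.mul_sum, h]
    ring

@[fun_prop]
lemma hasTemperateGrowth_bulkCurrent (ω : ℝ) :
    Function.HasTemperateGrowth fun X : Phase N => bulkCurrent ω X := by
  unfold bulkCurrent
  fun_prop

@[fun_prop]
lemma hasTemperateGrowth_edgeCurrent :
    Function.HasTemperateGrowth fun X : Phase N => edgeCurrent X := by
  unfold edgeCurrent
  fun_prop

@[fun_prop]
lemma hasTemperateGrowth_totalCurrent (ω : ℝ) :
    Function.HasTemperateGrowth fun X : Phase N => totalCurrent ω X := by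
  simp only [totalCurrent_eq]
  fun_prop

lemma pos_single_inr (i : Fin N) (k : ℕ) :
    pos (Pi.single (Sum.inr i) 1 : Phase N) k = 0 := by
  rcases k with _ | k
  · rfl
  · simp [pos, entry]

lemma mom_single_inr (i : Fin N) (k : ℕ) :
    mom (Pi.single (Sum.inr i) 1 : Phase N) (k + 1) = if k = i then 1 else 0 := by
  by_cases h : k < N
  · simp [mom, entry, h, Pi.single_apply, Fin.ext_iff]
  · have : k ≠ i := by omega
    simp [mom, entry, h, this]

lemma energyForm_single_inr (ω γ : ℝ) (i : Fin N) (X : Phase N) :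
    energyForm ω γ X (Pi.single (Sum.inr i) 1) = mom X (i + 1) := by
  simp [energyForm, pos_single_inr, mom_single_inr]

/-- Integrate by parts in the direction of a single momentum, which the energy form pairs to that
momentum; only the factor `mom X (l + 1)` can depend on it. -/
lemma integral_mom_mul {ω γ T : ℝ} (hγ : 0 < γ) (hT : 0 < T) {k l : ℕ} (hk : k < N)
    (L₁ L₂ : Phase N →L[ℝ] ℝ) (h₁ : L₁ (Pi.single (Sum.inr ⟨k, hk⟩) 1) = 0)
    (h₂ : L₂ (Pi.single (Sum.inr ⟨k, hk⟩) 1) = 0) :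
    ∫ X, mom X (k + 1) * (L₁ X * L₂ X * mom X (l + 1)) ∂gibbs ω γ T N =
      if l = k then T * ∫ X, L₁ X * L₂ X ∂gibbs ω γ T N else 0 := by
  have h := integral_energyForm_mul_mul_mul (ω := ω) hγ hT (Pi.single (Sum.inr ⟨k, hk⟩) 1) L₁ L₂
    (momL N (l + 1))
  simp only [energyForm_single_inr, h₁, h₂, momL_apply, mom_single_inr] at h
  rw [h]
  split_ifs <;> simp

lemma integral_bulkCurrent_sq {ω γ T : ℝ} (hγ : 0 < γ) (hT : 0 < T) :
    ∫ X, bulkCurrent ω X ^ 2 ∂gibbs ω γ T N = ω ^ 4 / 4 * T *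
      ∑ k ∈ Finset.range N, ∫ X, (pos X (k + 2) - pos X k) ^ 2 ∂gibbs ω γ T N := by
  have h (X : Phase N) : bulkCurrent ω X ^ 2 = ∑ k ∈ Finset.range N, ∑ l ∈ Finset.range N,
      ω ^ 4 / 4 * (mom X (k + 1) *
        ((pos X (k + 2) - pos X k) * (pos X (l + 2) - pos X l) * mom X (l + 1))) := by
    rw [bulkCurrent, mul_pow, sq (∑ k ∈ Finset.range N, _), Finset.sum_mul_sum, Finset.mul_sum]
    refine Finset.sum_congr rfl fun k _ => ?_
    rw [Finset.mul_sum]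
    exact Finset.sum_congr rfl fun l _ => by ring
  simp only [h]
  rw [integral_finsetSum _ fun k _ => integrable_gibbs hγ hT (by fun_prop), Finset.mul_sum]
  refine Finset.sum_congr rfl fun k hk => ?_
  rw [integral_finsetSum _ fun l _ => integrable_gibbs hγ hT (by fun_prop)]
  have hk' := Finset.mem_range.1 hk
  have hl (l : ℕ) : ∫ X, ω ^ 4 / 4 * (mom X (k + 1) *
      ((pos X (k + 2) - pos X k) * (pos X (l + 2) - pos X l) * mom X (l + 1))) ∂gibbs ω γ T N =
      if l = k then ω ^ 4 / 4 * T * ∫ X, (pos X (k + 2) - pos X k) ^ 2 ∂gibbs ω γ T N else 0 := by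
    have := integral_mom_mul (ω := ω) hγ hT (l := l) hk' (posL N (k + 2) - posL N k)
      (posL N (l + 2) - posL N l) (by simp [posL_apply, pos_single_inr])
      (by simp [posL_apply, pos_single_inr])
    simp only [_root_.sub_apply, posL_apply] at this
    rw [integral_const_mul, this]
    split_ifs with hlk
    · subst hlk; simp only [sq, mul_assoc]
    · simp
  simp only [hl, Finset.sum_ite_eq', hk, if_true]

/-! ### Two-point functions of the positions -/

/-- The profile `k ↦ r ^ |k - j|` on the chain, as a vector of positions. -/
def profile (N : ℕ) (r : ℝ) (j : ℕ) : Phase N :=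
  Sum.elim (fun i => r ^ Nat.dist (i + 1) j) fun _ => 0

lemma mom_profile (r : ℝ) (j k : ℕ) : mom (profile N r j) k = 0 := by
  rcases k with _ | k
  · rfl
  · simp [mom, entry, profile]

lemma pos_profile (r : ℝ) (j : ℕ) {k : ℕ} (hk : k < N) :
    pos (profile N r j) (k + 1) = r ^ Nat.dist (k + 1) j := by
  rw [pos_fin _ ⟨k, hk⟩]; simp [profile]

lemma pow_dist_eq {r : ℝ} (hr : r ≠ 0) (k j : ℕ) :
    (r + 1 / r) * r ^ Nat.dist (k + 1) j - r ^ Nat.dist (k + 2) j - r ^ Nat.dist k j =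
      if k + 1 = j then 1 / r - r else 0 := by
  simp only [Nat.dist]
  rcases lt_trichotomy (k + 1) j with h | h | h
  · obtain ⟨d, rfl⟩ := Nat.exists_eq_add_of_lt h
    rw [if_neg (by omega), show k + 1 - (k + 1 + d + 1) + (k + 1 + d + 1 - (k + 1)) = d + 1 by omega,
      show k + 2 - (k + 1 + d + 1) + (k + 1 + d + 1 - (k + 2)) = d by omega,
      show k - (k + 1 + d + 1) + (k + 1 + d + 1 - k) = d + 2 by omega]
    field_simp; ring
  · subst h
    rw [if_pos rfl, show k + 1 - (k + 1) + (k + 1 - (k + 1)) = 0 by omega,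
      show k + 2 - (k + 1) + (k + 1 - (k + 2)) = 1 by omega,
      show k - (k + 1) + (k + 1 - k) = 1 by omega]
    ring
  · obtain ⟨d, hd⟩ := Nat.exists_eq_add_of_le (Nat.lt_succ_iff.1 h)
    subst hd
    rw [if_neg (by omega), show j + d + 1 - j + (j - (j + d + 1)) = d + 1 by omega,
      show j + d + 2 - j + (j - (j + d + 2)) = d + 2 by omega,
      show j + d - j + (j - (j + d)) = d by omega]
    field_simp; ring

/-- On the infinite line `r^|k-j|` is a multiple of the Green function of the force operator. The
two other sources appear because the profile is cut to zero at the sites `0` and `N + 1`. -/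
lemma force_profile {ω γ r : ℝ} (hr : r ≠ 0) (h : ω ^ 2 * (r + 1 / r) = 2 * ω ^ 2 + γ ^ 2)
    {j k : ℕ} (hj : j ≤ N) (hk : k < N) :
    force ω γ (profile N r j) k = (if k + 1 = j then ω ^ 2 * (1 / r - r) else 0) +
      (if k = 0 then ω ^ 2 * r ^ j else 0) + (if k + 1 = N then ω ^ 2 * r ^ (N + 1 - j) else 0) := by
  have h0 : pos (profile N r j) k = r ^ Nat.dist k j - if k = 0 then r ^ j else 0 := by
    rcases k with _ | k
    · simp [Nat.dist]
    · simp [pos_profile r j (show k < N by omega)]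
  have h2 : pos (profile N r j) (k + 2) =
      r ^ Nat.dist (k + 2) j - if k + 1 = N then r ^ (N + 1 - j) else 0 := by
    by_cases hkN : k + 1 = N
    · rw [pos_of_lt _ (by omega), if_pos hkN, Nat.dist, show k + 2 - j + (j - (k + 2)) = N + 1 - j by
        omega, sub_self]
    · simp [pos_profile r j (show k + 1 < N by omega), hkN]
  have h3 := congrArg (fun z => ω ^ 2 * z) (pow_dist_eq hr k j)
  simp only [mul_sub, ← mul_assoc, h] at h3
  rw [force, h0, h2, pos_profile r j hk]
  split_ifs at h3 ⊢ <;> linear_combination h3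

lemma integral_pos_mul_pos_abs_le {ω γ T : ℝ} (hγ : 0 < γ) (hT : 0 < T) (i j : ℕ) :
    |∫ X, pos X i * pos X j ∂gibbs ω γ T N| ≤ T / min 1 (γ ^ 2) := by
  have hm : 0 < min 1 (γ ^ 2) := lt_min one_pos (by positivity)
  have h1 (k : ℕ) : ∫ X, pos X k ^ 2 ∂gibbs ω γ T N ≤ T / min 1 (γ ^ 2) := by
    have h := integral_sq_le (ω := ω) hγ hT (posL N k)
    simp only [posL_apply] at h
    refine h.trans (mul_le_of_le_one_right (by positivity) ?_)
    rcases k with _ | k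
    · simp [normSq]
    by_cases hk : k < N
    · have : ∀ a : Site N, pos (Pi.single a 1 : Phase N) (k + 1) =
          if a = Sum.inl ⟨k, hk⟩ then 1 else 0 := fun a => by
        rw [pos_fin _ ⟨k, hk⟩, Pi.single_apply]; simp only [eq_comm]
      simp [normSq, this]
    · simp [normSq, pos_of_lt _ (show N < k + 1 by omega)]
  calc |∫ X, pos X i * pos X j ∂gibbs ω γ T N|
      ≤ ∫ X, |pos X i * pos X j| ∂gibbs ω γ T N := abs_integral_le_integral_abs
    _ ≤ ∫ X, (pos X i ^ 2 * (1 / 2) + pos X j ^ 2 * (1 / 2)) ∂gibbs ω γ T N := by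
        refine integral_mono (integrable_gibbs hγ hT (by fun_prop)).abs
          (integrable_gibbs hγ hT (by fun_prop)) fun X => ?_
        simp only
        rw [abs_mul, ← sq_abs (pos X i), ← sq_abs (pos X j)]
        nlinarith [sq_nonneg (|pos X i| - |pos X j|)]
    _ = (∫ X, pos X i ^ 2 ∂gibbs ω γ T N) * (1 / 2) +
        (∫ X, pos X j ^ 2 ∂gibbs ω γ T N) * (1 / 2) := by
        rw [integral_add (integrable_gibbs hγ hT (by fun_prop))
          (integrable_gibbs hγ hT (by fun_prop)), integral_mul_const, integral_mul_const]
    _ ≤ _ := by linarith [h1 i, h1 j]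

/-- Integration by parts in the direction of the profile at `j`, tested with `q_i`. The boundary
sources remain as unknown covariances with `q_1` and `q_N`; an a priori bound on these suffices, as
their weights decay away from the ends. -/
lemma integral_pos_mul_pos {ω γ T r : ℝ} (hγ : 0 < γ) (hT : 0 < T) (hr : r ≠ 0)
    (h : ω ^ 2 * (r + 1 / r) = 2 * ω ^ 2 + γ ^ 2) {i j : ℕ} (hi : 1 ≤ i) (hi' : i ≤ N)
    (hj : 1 ≤ j) (hj' : j ≤ N) :
    ω ^ 2 * (1 / r - r) * ∫ X, pos X i * pos X j ∂gibbs ω γ T N +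
      ω ^ 2 * r ^ j * ∫ X, pos X i * pos X 1 ∂gibbs ω γ T N +
      ω ^ 2 * r ^ (N + 1 - j) * ∫ X, pos X i * pos X N ∂gibbs ω γ T N =
      T * r ^ Nat.dist i j := by
  have h1 := integral_energyForm_mul (ω := ω) hγ hT (profile N r j) (posL N i)
  have h2 (X : Phase N) : energyForm ω γ X (profile N r j) = ω ^ 2 * (1 / r - r) * pos X j +
      ω ^ 2 * r ^ j * pos X 1 + ω ^ 2 * r ^ (N + 1 - j) * pos X N := by
    rw [energyForm_comm, energyForm]
    have : ∀ k ∈ Finset.range N, mom (profile N r j) (k + 1) * mom X (k + 1) +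
        force ω γ (profile N r j) k * pos X (k + 1) =
        (if k = j - 1 then ω ^ 2 * (1 / r - r) * pos X j else 0) +
        (if k = 0 then ω ^ 2 * r ^ j * pos X 1 else 0) +
        (if k = N - 1 then ω ^ 2 * r ^ (N + 1 - j) * pos X N else 0) := by
      intro k hk
      have hk' := Finset.mem_range.1 hk
      have e1 : k = j - 1 ↔ k + 1 = j := by omega
      have e2 : k = N - 1 ↔ k + 1 = N := by omega
      rw [mom_profile, force_profile hr h hj' hk', zero_mul, zero_add, add_mul, add_mul, ite_mul,
        ite_mul, ite_mul]
      simp only [e1, e2, zero_mul]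
      refine congrArg₂ _ (congrArg₂ _ ?_ ?_) ?_
      · split_ifs with hh
        · rw [hh]
        · rfl
      · split_ifs with hh
        · rw [hh]
        · rfl
      · split_ifs with hh
        · rw [hh]
        · rfl
    rw [Finset.sum_congr rfl this, Finset.sum_add_distrib, Finset.sum_add_distrib,
      Finset.sum_ite_eq', Finset.sum_ite_eq', Finset.sum_ite_eq', if_pos, if_pos, if_pos] <;>
    · rw [Finset.mem_range]; omega
  have hi2 : pos (profile N r j) i = r ^ Nat.dist i j := by
    obtain ⟨i, rfl⟩ := Nat.exists_eq_add_of_le' hi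
    exact pos_profile r j (by omega)
  have h3 (X : Phase N) : (ω ^ 2 * (1 / r - r) * pos X j +
      ω ^ 2 * r ^ j * pos X 1 + ω ^ 2 * r ^ (N + 1 - j) * pos X N) * pos X i =
      ω ^ 2 * (1 / r - r) * (pos X i * pos X j) + ω ^ 2 * r ^ j * (pos X i * pos X 1) +
        ω ^ 2 * r ^ (N + 1 - j) * (pos X i * pos X N) := by ring
  simp only [h2, posL_apply, hi2, h3] at h1
  rw [← h1, integral_add (integrable_gibbs hγ hT (by fun_prop))
    (integrable_gibbs hγ hT (by fun_prop)), integral_add (integrable_gibbs hγ hT (by fun_prop))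
    (integrable_gibbs hγ hT (by fun_prop)), integral_const_mul, integral_const_mul,
    integral_const_mul]

lemma abs_integral_pos_mul_pos_sub_le {ω γ T r : ℝ} (hγ : 0 < γ) (hT : 0 < T) (hr : 0 < r)
    (h : ω ^ 2 * (r + 1 / r) = 2 * ω ^ 2 + γ ^ 2) {i j : ℕ} (hi : 1 ≤ i) (hi' : i ≤ N)
    (hj : 1 ≤ j) (hj' : j ≤ N) :
    |ω ^ 2 * (1 / r - r) * ∫ X, pos X i * pos X j ∂gibbs ω γ T N - T * r ^ Nat.dist i j| ≤
      ω ^ 2 * (T / min 1 (γ ^ 2)) * (r ^ j + r ^ (N + 1 - j)) := by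
  rw [← integral_pos_mul_pos hγ hT hr.ne' h hi hi' hj hj']
  have h1 := integral_pos_mul_pos_abs_le (N := N) (ω := ω) hγ hT i 1
  have h2 := integral_pos_mul_pos_abs_le (N := N) (ω := ω) hγ hT i N
  set G1 := ∫ X, pos X i * pos X 1 ∂gibbs ω γ T N
  set GN := ∫ X, pos X i * pos X N ∂gibbs ω γ T N
  set g := T / min 1 (γ ^ 2)
  rw [abs_le] at *
  have e1 : 0 ≤ ω ^ 2 * r ^ j := by positivity
  have e2 : 0 ≤ ω ^ 2 * r ^ (N + 1 - j) := by positivity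
  constructor <;> nlinarith [mul_le_mul_of_nonneg_left h1.1 e1, mul_le_mul_of_nonneg_left h1.2 e1,
    mul_le_mul_of_nonneg_left h2.1 e2, mul_le_mul_of_nonneg_left h2.2 e2]

/-! ### The variance of the bulk current -/

lemma integral_pos_sub_pos_sq {ω γ T : ℝ} (hγ : 0 < γ) (hT : 0 < T) (i j : ℕ) :
    ∫ X, (pos X i - pos X j) ^ 2 ∂gibbs ω γ T N =
      ∫ X, pos X i * pos X i ∂gibbs ω γ T N + ∫ X, pos X j * pos X j ∂gibbs ω γ T N -
        2 * ∫ X, pos X i * pos X j ∂gibbs ω γ T N := by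
  have h (X : Phase N) : (pos X i - pos X j) ^ 2 =
      pos X i * pos X i + pos X j * pos X j - 2 * (pos X i * pos X j) := by ring
  simp only [h]
  rw [integral_sub (integrable_gibbs hγ hT (by fun_prop)) (integrable_gibbs hγ hT (by fun_prop)),
    integral_add (integrable_gibbs hγ hT (by fun_prop)) (integrable_gibbs hγ hT (by fun_prop)),
    integral_const_mul]

/-- The bound only has to be summable over `k` uniformly in `N`. In the constant, `4 ω²` counts the
errors of the covariances in the interior, and the other two summands serve the end sites. -/
lemma abs_integral_sq_sub_le {ω γ T r : ℝ} (hγ : 0 < γ) (hT : 0 < T) (hr : 0 < r) (hr1 : r < 1)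
    (h : ω ^ 2 * (r + 1 / r) = 2 * ω ^ 2 + γ ^ 2) {k : ℕ} (hk : k < N) :
    |ω ^ 2 * (1 / r - r) * ∫ X, (pos X (k + 2) - pos X k) ^ 2 ∂gibbs ω γ T N -
        T * (2 - 2 * r ^ 2)| ≤
      (4 * ω ^ 2 * (T / min 1 (γ ^ 2)) + 4 * (ω ^ 2 * (1 / r - r)) * (T / min 1 (γ ^ 2)) + 2 * T) *
        (r ^ k + r ^ (N - 1 - k)) := by
  have hm : 0 < min 1 (γ ^ 2) := lt_min one_pos (by positivity)
  have hc : 0 ≤ ω ^ 2 * (1 / r - r) := by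
    have : 1 ≤ 1 / r := by rw [le_div_iff₀ hr]; linarith
    exact mul_nonneg (sq_nonneg _) (by linarith)
  rw [integral_pos_sub_pos_sq hγ hT]
  set c := ω ^ 2 * (1 / r - r)
  set g := T / min 1 (γ ^ 2)
  have hg : 0 ≤ g := by positivity
  have hp1 : 0 ≤ r ^ k := by positivity
  have hp2 : 0 ≤ r ^ (N - 1 - k) := by positivity
  by_cases hb : 1 ≤ k ∧ k + 2 ≤ N
  · have h1 := abs_integral_pos_mul_pos_sub_le (N := N) hγ hT hr h
      (show 1 ≤ k + 2 by omega) hb.2 (show 1 ≤ k + 2 by omega) hb.2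
    have h2 := abs_integral_pos_mul_pos_sub_le (N := N) hγ hT hr h
      hb.1 hk.le hb.1 hk.le
    have h3 := abs_integral_pos_mul_pos_sub_le (N := N) hγ hT hr h
      (show 1 ≤ k + 2 by omega) hb.2 hb.1 hk.le
    rw [Nat.dist_self, pow_zero] at h1 h2
    rw [show Nat.dist (k + 2) k = 2 by simp [Nat.dist]] at h3
    have e1 : r ^ (k + 2) ≤ r ^ k := pow_le_pow_of_le_one hr.le hr1.le (by omega)
    have e2 : r ^ (N + 1 - (k + 2)) = r ^ (N - 1 - k) := by congr 1; omega
    have e3 : r ^ (N + 1 - k) ≤ r ^ (N - 1 - k) := pow_le_pow_of_le_one hr.le hr1.le (by omega)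
    have hωg : 0 ≤ ω ^ 2 * g := by positivity
    have f1 := h1.trans (mul_le_mul_of_nonneg_left (add_le_add e1 e2.le) hωg)
    have f2 := h2.trans (mul_le_mul_of_nonneg_left (add_le_add_right e3 (r ^ k)) hωg)
    have f3 := h3.trans (mul_le_mul_of_nonneg_left (add_le_add_right e3 (r ^ k)) hωg)
    have hrest : 0 ≤ (4 * c * g + 2 * T) * (r ^ k + r ^ (N - 1 - k)) := by positivity
    rw [abs_le] at *
    constructor <;> linarith [f1.1, f1.2, f2.1, f2.2, f3.1, f3.2]
  -- Here `q_0` or `q_{N+1}` enters and the covariance formula is not available, but one of the two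
  -- powers of `r` equals `1`, so a crude bound is enough.
  · have h1 := integral_pos_mul_pos_abs_le (N := N) (ω := ω) hγ hT (k + 2) (k + 2)
    have h2 := integral_pos_mul_pos_abs_le (N := N) (ω := ω) hγ hT k k
    have h3 := integral_pos_mul_pos_abs_le (N := N) (ω := ω) hγ hT (k + 2) k
    have hone : 1 ≤ r ^ k + r ^ (N - 1 - k) := by
      rcases Nat.eq_zero_or_pos k with h0 | h0
      · subst h0; simpa using hp2
      · rw [show N - 1 - k = 0 by omega, pow_zero]; linarith
    have hK : 0 ≤ 4 * ω ^ 2 * g + 4 * c * g + 2 * T := by positivity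
    refine le_trans ?_ (le_mul_of_one_le_right hK hone)
    have hωg : 0 ≤ ω ^ 2 * g := by positivity
    have hr2 : 0 ≤ T * r ^ 2 := by positivity
    have hr3 : T * r ^ 2 ≤ T := mul_le_of_le_one_right hT.le (pow_le_one₀ hr.le hr1.le)
    rw [abs_le] at *
    constructor <;> nlinarith [mul_le_mul_of_nonneg_left h1.1 hc, mul_le_mul_of_nonneg_left h1.2 hc,
      mul_le_mul_of_nonneg_left h2.1 hc, mul_le_mul_of_nonneg_left h2.2 hc,
      mul_le_mul_of_nonneg_left h3.1 hc, mul_le_mul_of_nonneg_left h3.2 hc]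

lemma sum_pow_add_pow_le {r : ℝ} (hr : 0 < r) (hr1 : r < 1) (N : ℕ) :
    ∑ k ∈ Finset.range N, (r ^ k + r ^ (N - 1 - k)) ≤ 2 * (1 - r)⁻¹ := by
  rw [Finset.sum_add_distrib, Finset.sum_range_reflect (fun k => r ^ k) N]
  have : ∑ k ∈ Finset.range N, r ^ k ≤ (1 - r)⁻¹ := by
    rw [← tsum_geometric_of_lt_one hr.le hr1]
    exact (summable_geometric_of_lt_one hr.le hr1).sum_le_tsum _ fun _ _ => by positivity
  linarith

lemma tendsto_integral_bulkCurrent_sq {ω γ T r : ℝ} (hω : 0 < ω) (hγ : 0 < γ) (hT : 0 < T)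
    (hr : 0 < r) (hr1 : r < 1) (h : ω ^ 2 * (r + 1 / r) = 2 * ω ^ 2 + γ ^ 2) :
    Tendsto (fun N : ℕ => 1 / ((N : ℝ) + 1) * ∫ X, bulkCurrent ω X ^ 2 ∂gibbs ω γ T N) atTop
      (𝓝 (T ^ 2 * ω ^ 2 * r / 2)) := by
  set c := ω ^ 2 * (1 / r - r) with hcdef
  have hc : 0 < c := by
    have : 1 < 1 / r := by rw [lt_div_iff₀ hr]; linarith
    exact mul_pos (by positivity) (by linarith)
  set S : ℕ → ℝ := fun N =>
    ∑ k ∈ Finset.range N, ∫ X, (pos X (k + 2) - pos X k) ^ 2 ∂gibbs ω γ T N with hS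
  obtain ⟨K, hK⟩ : ∃ K, ∀ N, |c * S N - N * (T * (2 - 2 * r ^ 2))| ≤ K := by
    refine ⟨(4 * ω ^ 2 * (T / min 1 (γ ^ 2)) + 4 * c * (T / min 1 (γ ^ 2)) + 2 * T) *
      (2 * (1 - r)⁻¹), fun N => ?_⟩
    have h1 : c * S N - N * (T * (2 - 2 * r ^ 2)) = ∑ k ∈ Finset.range N,
        (c * ∫ X, (pos X (k + 2) - pos X k) ^ 2 ∂gibbs ω γ T N - T * (2 - 2 * r ^ 2)) := by
      rw [Finset.sum_sub_distrib, ← Finset.mul_sum]; simp [hS]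
    rw [h1]
    refine (Finset.abs_sum_le_sum_abs _ _).trans ((Finset.sum_le_sum fun k hk =>
      abs_integral_sq_sub_le hγ hT hr hr1 h (Finset.mem_range.1 hk)).trans ?_)
    rw [← Finset.mul_sum]
    have : 0 < min 1 (γ ^ 2) := lt_min one_pos (by positivity)
    exact mul_le_mul_of_nonneg_left (sum_pow_add_pow_le hr hr1 N) (by positivity)
  have hlim1 : Tendsto (fun N : ℕ => 1 / ((N : ℝ) + 1)) atTop (𝓝 0) :=
    tendsto_one_div_add_atTop_nhds_zero_nat
  have hlim2 : Tendsto (fun N : ℕ => 1 / ((N : ℝ) + 1) * (c * S N - N * (T * (2 - 2 * r ^ 2))))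
      atTop (𝓝 0) := by
    refine squeeze_zero_norm (a := fun N : ℕ => 1 / ((N : ℝ) + 1) * K) (fun N => ?_)
      (by simpa using hlim1.mul_const K)
    rw [norm_mul, Real.norm_of_nonneg (by positivity : (0 : ℝ) ≤ 1 / ((N : ℝ) + 1))]
    exact mul_le_mul_of_nonneg_left (hK N) (by positivity)
  have hlim3 : Tendsto (fun N : ℕ => 1 / ((N : ℝ) + 1) * (N * (T * (2 - 2 * r ^ 2)))) atTop
      (𝓝 (T * (2 - 2 * r ^ 2))) := by
    have := ((tendsto_const_nhds (x := (1 : ℝ))).sub hlim1).mul_const (T * (2 - 2 * r ^ 2))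
    rw [sub_zero, one_mul] at this
    refine this.congr fun N => ?_
    have : (N : ℝ) + 1 ≠ 0 := by positivity
    field_simp
    ring
  have hlim4 := (hlim2.add hlim3).const_mul (ω ^ 4 / 4 * T / c)
  -- Since `c = ω² (1 - r²) / r`, the factor `1 - r²` cancels.
  have hval : ω ^ 4 / 4 * T / c * (0 + T * (2 - 2 * r ^ 2)) = T ^ 2 * ω ^ 2 * r / 2 := by
    have h2 : c = ω ^ 2 * (1 - r ^ 2) / r := by rw [hcdef]; field_simp
    have h3 : 1 - r ^ 2 ≠ 0 := by nlinarith
    rw [h2]; field_simp; ring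
  rw [hval] at hlim4
  refine hlim4.congr fun N => ?_
  rw [integral_bulkCurrent_sq hγ hT]
  have : (N : ℝ) + 1 ≠ 0 := by positivity
  simp only [hS]
  field_simp
  ring

/-! ### Correlations along the flow -/

/-- The bilinear form of the bulk current. -/
def bulkForm (ω : ℝ) (N : ℕ) : Phase N →L[ℝ] Phase N →L[ℝ] ℝ :=
  ∑ k ∈ Finset.range N,
    (-(ω ^ 2 / 2)) • (posL N (k + 2) - posL N k).smulRight (momL N (k + 1))

lemma bulkForm_apply (ω : ℝ) (X Y : Phase N) : bulkForm ω N X Y =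
    -(ω ^ 2 / 2) * ∑ k ∈ Finset.range N, (pos X (k + 2) - pos X k) * mom Y (k + 1) := by
  simp [bulkForm, _root_.sum_apply, posL_apply, momL_apply, Finset.mul_sum]

/-- The heart of the computation. Apart from friction, every contribution is a telescoping sum: of
`p_{k+1} p_k`, of `q_{k+1} q_k`, and of `q_{k+1}² + q_k²`. The first two vanish by the boundary
values; the last leaves the end positions. -/
lemma bulkForm_driftL (ω γ lam : ℝ) (hω : ω ≠ 0) (X : Phase N) :
    bulkForm ω N (driftL ω γ lam N X) X + bulkForm ω N X (driftL ω γ lam N X) =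
      lam * bulkCurrent ω X + ω ^ 4 / 2 * (pos X N ^ 2 - pos X 1 ^ 2) := by
  have h1 := Finset.sum_range_sub (fun k => mom X (k + 1) * mom X k) N
  have h2 := Finset.sum_range_sub (fun k => pos X (k + 1) * pos X k) N
  have h3 := Finset.sum_range_sub (fun k => pos X (k + 1) ^ 2 + pos X k ^ 2) N
  rw [mom_of_lt X (Nat.lt_succ_self N), mom_zero] at h1
  rw [pos_of_lt X (Nat.lt_succ_self N), pos_zero] at h2 h3
  have h : ∑ k ∈ Finset.range N, (pos (driftL ω γ lam N X) (k + 2) -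
      pos (driftL ω γ lam N X) k) * mom X (k + 1) + ∑ k ∈ Finset.range N,
      (pos X (k + 2) - pos X k) * mom (driftL ω γ lam N X) (k + 1) =
      -∑ k ∈ Finset.range N, (mom X (k + 1 + 1) * mom X (k + 1) - mom X (k + 1) * mom X k) +
      (2 * ω ^ 2 + γ ^ 2) * ∑ k ∈ Finset.range N,
        (pos X (k + 1 + 1) * pos X (k + 1) - pos X (k + 1) * pos X k) -
      ω ^ 2 * ∑ k ∈ Finset.range N,
        (pos X (k + 1 + 1) ^ 2 + pos X (k + 1) ^ 2 - (pos X (k + 1) ^ 2 + pos X k ^ 2)) +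
      lam * ∑ k ∈ Finset.range N, (pos X (k + 2) - pos X k) * mom X (k + 1) := by
    simp only [Finset.mul_sum, ← Finset.sum_neg_distrib, ← Finset.sum_add_distrib,
      ← Finset.sum_sub_distrib]
    refine Finset.sum_congr rfl fun k hk => ?_
    rw [pos_driftL, pos_driftL, mom_driftL ω γ lam hω X (Finset.mem_range.1 hk), force]
    ring
  rw [bulkForm_apply, bulkForm_apply, ← mul_add, h, h1, h2, h3, bulkCurrent]
  ring

lemma bulkForm_self (ω : ℝ) (X : Phase N) : bulkForm ω N X X = bulkCurrent ω X :=
  bulkForm_apply ω X X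

/-- Expansion in coordinates separates the linear maps from the moments, so a time derivative acts
on finitely many coefficients and need not be taken under the integral. -/
lemma integral_bilinear_mul {ω γ T : ℝ} (hγ : 0 < γ) (hT : 0 < T)
    (b : Phase N →L[ℝ] Phase N →L[ℝ] ℝ) (L₁ L₂ : Phase N →L[ℝ] Phase N) {φ : Phase N → ℝ}
    (hφ : φ.HasTemperateGrowth) :
    ∫ X, b (L₁ X) (L₂ X) * φ X ∂gibbs ω γ T N = ∑ a, ∑ c,
      b (L₁ (Pi.single a 1)) (L₂ (Pi.single c 1)) * ∫ X, X a * X c * φ X ∂gibbs ω γ T N := by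
  have h (X : Phase N) : b (L₁ X) (L₂ X) * φ X = ∑ a, ∑ c,
      b (L₁ (Pi.single a 1)) (L₂ (Pi.single c 1)) * (X a * X c * φ X) := by
    have hX : X = ∑ b, X b • (Pi.single b (1 : ℝ) : Phase N) := by
      ext c; simp [Finset.sum_apply, Pi.single_apply]
    conv_lhs => rw [hX]
    simp only [map_sum, map_smul, _root_.sum_apply, _root_.smul_apply, smul_eq_mul,
      Finset.sum_mul, Finset.mul_sum]
    rw [Finset.sum_comm]
    conv_lhs => rw [← hX]
    exact Finset.sum_congr rfl fun a _ => Finset.sum_congr rfl fun c _ => by ring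
  simp only [h]
  rw [integral_finsetSum _ fun a _ => integrable_gibbs hγ hT (by fun_prop)]
  refine Finset.sum_congr rfl fun a _ => ?_
  rw [integral_finsetSum _ fun c _ => integrable_gibbs hγ hT (by fun_prop)]
  exact Finset.sum_congr rfl fun c _ => integral_const_mul _ _

lemma hasDerivAt_integral_bilinear_flow {ω γ T : ℝ} (hγ : 0 < γ) (hT : 0 < T) (lam : ℝ)
    (b : Phase N →L[ℝ] Phase N →L[ℝ] ℝ) {φ : Phase N → ℝ} (hφ : φ.HasTemperateGrowth) (t : ℝ) :
    HasDerivAt (fun s => ∫ X, b (flow ω γ lam N s X) (flow ω γ lam N s X) * φ X ∂gibbs ω γ T N)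
      (-∫ X, (b (driftL ω γ lam N (flow ω γ lam N t X)) (flow ω γ lam N t X) +
        b (flow ω γ lam N t X) (driftL ω γ lam N (flow ω γ lam N t X))) * φ X ∂gibbs ω γ T N) t := by
  have hint (L₁ L₂ : Phase N →L[ℝ] Phase N) :
      Integrable (fun X => b (L₁ X) (L₂ X) * φ X) (gibbs ω γ T N) :=
    integrable_gibbs hγ hT
      ((b.bilinear_hasTemperateGrowth L₁.hasTemperateGrowth L₂.hasTemperateGrowth).mul hφ)
  have h1 := integral_bilinear_mul (ω := ω) hγ hT b
    ((driftL ω γ lam N).comp (flow ω γ lam N t)) (flow ω γ lam N t) hφ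
  have h2 := integral_bilinear_mul (ω := ω) hγ hT b (flow ω γ lam N t)
    ((driftL ω γ lam N).comp (flow ω γ lam N t)) hφ
  have i1 := hint ((driftL ω γ lam N).comp (flow ω γ lam N t)) (flow ω γ lam N t)
  have i2 := hint (flow ω γ lam N t) ((driftL ω γ lam N).comp (flow ω γ lam N t))
  simp only [ContinuousLinearMap.comp_apply] at h1 h2 i1 i2
  simp only [integral_bilinear_mul (ω := ω) hγ hT b _ _ hφ, add_mul]
  rw [integral_add i1 i2, h1, h2, ← Finset.sum_add_distrib, ← Finset.sum_neg_distrib]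
  refine HasDerivAt.fun_sum fun a _ => ?_
  rw [← Finset.sum_add_distrib, ← Finset.sum_neg_distrib]
  refine HasDerivAt.fun_sum fun c _ => ?_
  have hb := (b.hasFDerivAt.comp_hasDerivAt t
    (hasDerivAt_flow_apply ω γ lam t (Pi.single a 1))).clm_apply
    (hasDerivAt_flow_apply ω γ lam t (Pi.single c 1))
  refine (hb.mul_const _).congr_deriv ?_
  simp
  ring

/-! ### Decay of correlations -/

lemma normSq_posL_flow_le (ω γ lam : ℝ) (hω : ω ≠ 0) (hγ : 0 < γ) (hlam : 0 < lam) (k : ℕ)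
    {t : ℝ} (ht : 0 ≤ t) :
    normSq (fun a => (posL N k).comp (flow ω γ lam N t) (Pi.single a 1)) ≤
      decayConst ω γ lam * Real.exp (-decayRate γ lam * t) := by
  have h0 : 0 ≤ decayConst ω γ lam * Real.exp (-decayRate γ lam * t) :=
    mul_nonneg (decayConst_pos ω lam hγ).le (Real.exp_pos _).le
  simp only [ContinuousLinearMap.comp_apply, posL_apply]
  rcases k with _ | k
  · simpa [normSq] using h0
  by_cases hk : k < N
  · simp only [pos_fin _ ⟨k, hk⟩]
    exact normSq_flowRow_le ω γ lam hω hγ hlam _ ht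
  · simpa [normSq, pos_of_lt _ (show N < k + 1 by omega)] using h0

lemma normSq_momL_flow_le (ω γ lam : ℝ) (hω : ω ≠ 0) (hγ : 0 < γ) (hlam : 0 < lam) (k : ℕ)
    {t : ℝ} (ht : 0 ≤ t) :
    normSq (fun a => (momL N k).comp (flow ω γ lam N t) (Pi.single a 1)) ≤
      decayConst ω γ lam * Real.exp (-decayRate γ lam * t) := by
  have h0 : 0 ≤ decayConst ω γ lam * Real.exp (-decayRate γ lam * t) :=
    mul_nonneg (decayConst_pos ω lam hγ).le (Real.exp_pos _).le
  simp only [ContinuousLinearMap.comp_apply, momL_apply]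
  rcases k with _ | k
  · simpa [normSq] using h0
  by_cases hk : k < N
  · simp only [mom_fin _ ⟨k, hk⟩]
    exact normSq_flowRow_le ω γ lam hω hγ hlam _ ht
  · simpa [normSq, mom_of_lt _ (show N < k + 1 by omega)] using h0

/-- Cauchy–Schwarz through Young's inequality, weighted so that each of the two terms contributes `a
b / 2`. -/
lemma abs_integral_mul_le {S : Type*} [MeasurableSpace S] {μ : Measure S} {f g : S → ℝ} {a b : ℝ}
    (ha : 0 < a) (hb : 0 < b) (hfg : Integrable (fun s => f s * g s) μ)
    (hf : Integrable (fun s => f s ^ 2) μ) (hg : Integrable (fun s => g s ^ 2) μ)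
    (hfa : ∫ s, f s ^ 2 ∂μ ≤ a ^ 2) (hgb : ∫ s, g s ^ 2 ∂μ ≤ b ^ 2) :
    |∫ s, f s * g s ∂μ| ≤ a * b := by
  calc |∫ s, f s * g s ∂μ| ≤ ∫ s, |f s * g s| ∂μ := abs_integral_le_integral_abs
    _ ≤ ∫ s, (b / (2 * a) * f s ^ 2 + a / (2 * b) * g s ^ 2) ∂μ := by
        refine integral_mono hfg.abs ((hf.const_mul _).add (hg.const_mul _)) fun s => ?_
        simp only
        have h : b / (2 * a) * f s ^ 2 + a / (2 * b) * g s ^ 2 - |f s * g s| =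
            (b * |f s| - a * |g s|) ^ 2 / (2 * a * b) := by
          rw [abs_mul, ← sq_abs (f s), ← sq_abs (g s)]; field_simp; ring
        have : 0 ≤ (b * |f s| - a * |g s|) ^ 2 / (2 * a * b) := by positivity
        linarith
    _ = b / (2 * a) * ∫ s, f s ^ 2 ∂μ + a / (2 * b) * ∫ s, g s ^ 2 ∂μ := by
        rw [integral_add (hf.const_mul _) (hg.const_mul _), integral_const_mul, integral_const_mul]
    _ ≤ b / (2 * a) * a ^ 2 + a / (2 * b) * b ^ 2 := by gcongr
    _ = a * b := by field_simp; ring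

lemma integral_mul_sq_le {ω γ T D : ℝ} (hγ : 0 < γ) (hT : 0 < T)
    (L₁ L₂ : Phase N →L[ℝ] ℝ) (h₁ : normSq (fun a => L₁ (Pi.single a 1)) ≤ D)
    (h₂ : normSq (fun a => L₂ (Pi.single a 1)) ≤ D) :
    ∫ X, (L₁ X * L₂ X) ^ 2 ∂gibbs ω γ T N ≤ (2 * (T / min 1 (γ ^ 2)) * D) ^ 2 := by
  have hm : 0 < min 1 (γ ^ 2) := lt_min one_pos (by positivity)
  have t₁ := L₁.hasTemperateGrowth
  have t₂ := L₂.hasTemperateGrowth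
  have hb (L : Phase N →L[ℝ] ℝ) (hL : normSq (fun a => L (Pi.single a 1)) ≤ D) :
      ∫ X, L X ^ 4 ∂gibbs ω γ T N ≤ 3 * (T / min 1 (γ ^ 2) * D) ^ 2 := by
    refine (integral_pow_four_le hγ hT L).trans ?_
    have := normSq_nonneg fun a => L (Pi.single a 1)
    gcongr
  calc ∫ X, (L₁ X * L₂ X) ^ 2 ∂gibbs ω γ T N
      ≤ ∫ X, (1 / 2 * L₁ X ^ 4 + 1 / 2 * L₂ X ^ 4) ∂gibbs ω γ T N := by
        refine integral_mono (integrable_gibbs hγ hT (by fun_prop))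
          (integrable_gibbs hγ hT (by fun_prop)) fun X => ?_
        simp only
        nlinarith [sq_nonneg (L₁ X ^ 2 - L₂ X ^ 2)]
    _ = 1 / 2 * ∫ X, L₁ X ^ 4 ∂gibbs ω γ T N + 1 / 2 * ∫ X, L₂ X ^ 4 ∂gibbs ω γ T N := by
        rw [integral_add (integrable_gibbs hγ hT (by fun_prop))
          (integrable_gibbs hγ hT (by fun_prop)), integral_const_mul, integral_const_mul]
    _ ≤ 3 * (T / min 1 (γ ^ 2) * D) ^ 2 := by linarith [hb L₁ h₁, hb L₂ h₂]
    -- The Wick factor `3` is enlarged to `4` to obtain a perfect square.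
    _ ≤ _ := by nlinarith [sq_nonneg (T / min 1 (γ ^ 2) * D)]

lemma abs_integral_mul_mul_le {ω γ T D b : ℝ} (hγ : 0 < γ) (hT : 0 < T) (hD : 0 < D) (hb : 0 < b)
    (L₁ L₂ : Phase N →L[ℝ] ℝ) (h₁ : normSq (fun a => L₁ (Pi.single a 1)) ≤ D)
    (h₂ : normSq (fun a => L₂ (Pi.single a 1)) ≤ D) {φ : Phase N → ℝ}
    (hφ : φ.HasTemperateGrowth) (hφb : ∫ X, φ X ^ 2 ∂gibbs ω γ T N ≤ b ^ 2) :
    |∫ X, L₁ X * L₂ X * φ X ∂gibbs ω γ T N| ≤ 2 * (T / min 1 (γ ^ 2)) * D * b := by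
  have hm : 0 < min 1 (γ ^ 2) := lt_min one_pos (by positivity)
  have t₁ := L₁.hasTemperateGrowth
  have t₂ := L₂.hasTemperateGrowth
  exact abs_integral_mul_le (by positivity) hb (integrable_gibbs hγ hT (by fun_prop))
    (integrable_gibbs hγ hT (by fun_prop)) (integrable_gibbs hγ hT (by fun_prop))
    (integral_mul_sq_le hγ hT L₁ L₂ h₁ h₂) hφb

/-- The amplitude of the correlations of products of two coordinates along the flow. -/
def corrConst (ω γ lam T : ℝ) : ℝ := 2 * (T / min 1 (γ ^ 2)) * decayConst ω γ lam

lemma corrConst_pos (ω lam : ℝ) {γ T : ℝ} (hγ : 0 < γ) (hT : 0 < T) :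
    0 < corrConst ω γ lam T := by
  have hm : 0 < min 1 (γ ^ 2) := lt_min one_pos (by positivity)
  have := decayConst_pos ω lam hγ
  rw [corrConst]; positivity

lemma hasDerivAt_integral_bulkCurrent_flow {ω γ T : ℝ} (hω : ω ≠ 0) (hγ : 0 < γ) (hT : 0 < T)
    (lam : ℝ) {φ : Phase N → ℝ} (hφ : φ.HasTemperateGrowth) (s : ℝ) :
    HasDerivAt (fun s => ∫ X, bulkCurrent ω (flow ω γ lam N s X) * φ X ∂gibbs ω γ T N)
      (-lam * ∫ X, bulkCurrent ω (flow ω γ lam N s X) * φ X ∂gibbs ω γ T N - ω ^ 4 / 2 *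
        ∫ X, (pos (flow ω γ lam N s X) N ^ 2 - pos (flow ω γ lam N s X) 1 ^ 2) * φ X
          ∂gibbs ω γ T N) s := by
  have h := hasDerivAt_integral_bilinear_flow (ω := ω) hγ hT lam (bulkForm ω N) hφ s
  simp only [bulkForm_driftL ω γ lam hω, bulkForm_self] at h
  refine h.congr_deriv ?_
  have t₀ := (flow ω γ lam N s).hasTemperateGrowth
  have tp (k : ℕ) : Function.HasTemperateGrowth fun X => pos (flow ω γ lam N s X) k :=
    (hasTemperateGrowth_pos k).comp t₀
  have tb : Function.HasTemperateGrowth fun X => bulkCurrent ω (flow ω γ lam N s X) :=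
    (hasTemperateGrowth_bulkCurrent ω).comp t₀
  simp only [add_mul, mul_assoc]
  rw [integral_add (integrable_gibbs hγ hT (by fun_prop))
    (integrable_gibbs hγ hT (by fun_prop)), integral_const_mul, integral_const_mul]
  ring

/-! ### Correlations of flowed observables with a fixed test function. -/

section

variable {ω γ lam T b t : ℝ} (hω : ω ≠ 0) (hγ : 0 < γ) (hlam : 0 < lam) (hT : 0 < T) (hb : 0 < b)
  (ht : 0 ≤ t) {φ : Phase N → ℝ} (hφ : φ.HasTemperateGrowth)
  (hφb : ∫ X, φ X ^ 2 ∂gibbs ω γ T N ≤ b ^ 2)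

include hω hγ hlam hT hb ht hφ hφb

lemma abs_integral_pos_mul_pos_flow_le (j k : ℕ) :
    |∫ X, pos (flow ω γ lam N t X) j * pos (flow ω γ lam N t X) k * φ X ∂gibbs ω γ T N| ≤
      corrConst ω γ lam T * Real.exp (-decayRate γ lam * t) * b := by
  have h := abs_integral_mul_mul_le hγ hT
    (mul_pos (decayConst_pos ω lam hγ) (Real.exp_pos (-decayRate γ lam * t))) hb _ _
    (normSq_posL_flow_le (N := N) ω γ lam hω hγ hlam j ht)
    (normSq_posL_flow_le (N := N) ω γ lam hω hγ hlam k ht) hφ hφb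
  simp only [ContinuousLinearMap.comp_apply, posL_apply] at h
  rw [corrConst]
  linarith

lemma abs_integral_pos_mul_mom_flow_le (j k : ℕ) :
    |∫ X, pos (flow ω γ lam N t X) j * mom (flow ω γ lam N t X) k * φ X ∂gibbs ω γ T N| ≤
      corrConst ω γ lam T * Real.exp (-decayRate γ lam * t) * b := by
  have h := abs_integral_mul_mul_le hγ hT
    (mul_pos (decayConst_pos ω lam hγ) (Real.exp_pos (-decayRate γ lam * t))) hb _ _
    (normSq_posL_flow_le (N := N) ω γ lam hω hγ hlam j ht)
    (normSq_momL_flow_le (N := N) ω γ lam hω hγ hlam k ht) hφ hφb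
  simp only [ContinuousLinearMap.comp_apply, posL_apply, momL_apply] at h
  rw [corrConst]
  linarith

lemma abs_integral_edgeCurrent_flow_le :
    |∫ X, edgeCurrent (flow ω γ lam N t X) * φ X ∂gibbs ω γ T N| ≤
      2 * (corrConst ω γ lam T * Real.exp (-decayRate γ lam * t) * b) := by
  have t₀ := (flow ω γ lam N t).hasTemperateGrowth
  simp only [edgeCurrent, sub_mul]
  have tp (k : ℕ) : Function.HasTemperateGrowth fun X => pos (flow ω γ lam N t X) k :=
    (hasTemperateGrowth_pos k).comp t₀
  have tm (k : ℕ) : Function.HasTemperateGrowth fun X => mom (flow ω γ lam N t X) k :=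
    (hasTemperateGrowth_mom k).comp t₀
  rw [integral_sub (integrable_gibbs hγ hT (by fun_prop))
    (integrable_gibbs hγ hT (by fun_prop))]
  refine (abs_sub _ _).trans ?_
  linarith [abs_integral_pos_mul_mom_flow_le hω hγ hlam hT hb ht hφ hφb N N,
    abs_integral_pos_mul_mom_flow_le hω hγ hlam hT hb ht hφ hφb 1 1]

lemma abs_integral_pos_sq_sub_flow_le :
    |∫ X, (pos (flow ω γ lam N t X) N ^ 2 - pos (flow ω γ lam N t X) 1 ^ 2) * φ X ∂gibbs ω γ T N| ≤
      2 * (corrConst ω γ lam T * Real.exp (-decayRate γ lam * t) * b) := by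
  have t₀ := (flow ω γ lam N t).hasTemperateGrowth
  have tp (k : ℕ) : Function.HasTemperateGrowth fun X => pos (flow ω γ lam N t X) k :=
    (hasTemperateGrowth_pos k).comp t₀
  simp only [sub_mul, sq]
  rw [integral_sub (integrable_gibbs hγ hT (by fun_prop))
    (integrable_gibbs hγ hT (by fun_prop))]
  refine (abs_sub _ _).trans ?_
  linarith [abs_integral_pos_mul_pos_flow_le hω hγ hlam hT hb ht hφ hφb N N,
    abs_integral_pos_mul_pos_flow_le hω hγ hlam hT hb ht hφ hφb 1 1]

/-- Multiplying by `exp(lam s)` removes the friction term and leaves only boundary terms in the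
derivative; the mean value inequality on `[0, t]` supplies the factor `t`. -/
lemma abs_integral_bulkCurrent_flow_sub_le :
    |∫ X, bulkCurrent ω (flow ω γ lam N t X) * φ X ∂gibbs ω γ T N -
        Real.exp (-lam * t) * ∫ X, bulkCurrent ω X * φ X ∂gibbs ω γ T N| ≤
      ω ^ 4 * corrConst ω γ lam T * b * (t * Real.exp (-decayRate γ lam * t)) := by
  set c := decayRate γ lam
  set u : ℝ → ℝ := fun s => ∫ X, bulkCurrent ω (flow ω γ lam N s X) * φ X ∂gibbs ω γ T N with hu
  set g : ℝ → ℝ := fun s =>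
    ∫ X, (pos (flow ω γ lam N s X) N ^ 2 - pos (flow ω γ lam N s X) 1 ^ 2) * φ X ∂gibbs ω γ T N
  have hd (s : ℝ) : HasDerivAt (fun s => Real.exp (lam * s) * u s)
      (Real.exp (lam * s) * (-(ω ^ 4 / 2) * g s)) s := by
    refine ((((hasDerivAt_id s).const_mul lam).exp).mul
      (hasDerivAt_integral_bulkCurrent_flow hω hγ hT lam hφ s)).congr_deriv ?_
    simp only [id, g]; ring
  have hcorr := corrConst_pos ω lam hγ hT
  have hbound : ∀ s ∈ Set.Icc (0 : ℝ) t, ‖Real.exp (lam * s) * (-(ω ^ 4 / 2) * g s)‖ ≤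
      ω ^ 4 * corrConst ω γ lam T * b * Real.exp ((lam - c) * t) := by
    intro s hs
    have h1 := abs_integral_pos_sq_sub_flow_le hω hγ hlam hT hb hs.1 hφ hφb
    -- As `c ≤ lam`, the bound is largest at the right end `s = t`.
    have h2 : Real.exp (lam * s) * Real.exp (-c * s) ≤ Real.exp ((lam - c) * t) := by
      rw [← Real.exp_add]
      refine Real.exp_le_exp.2 ?_
      have := mul_le_mul_of_nonneg_left hs.2 (sub_nonneg.2 (decayRate_le γ hlam))
      simp only [c]; linarith
    rw [norm_mul, norm_mul, norm_neg, Real.norm_of_nonneg (Real.exp_pos _).le,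
      Real.norm_of_nonneg (by positivity : (0 : ℝ) ≤ ω ^ 4 / 2), Real.norm_eq_abs]
    calc Real.exp (lam * s) * (ω ^ 4 / 2 * |g s|)
        ≤ Real.exp (lam * s) * (ω ^ 4 / 2 *
          (2 * (corrConst ω γ lam T * Real.exp (-c * s) * b))) := by gcongr
      _ = ω ^ 4 * corrConst ω γ lam T * b * (Real.exp (lam * s) * Real.exp (-c * s)) := by ring
      _ ≤ _ := by gcongr
  have h := (convex_Icc (0 : ℝ) t).norm_image_sub_le_of_norm_hasDerivWithin_le
    (fun s _ => (hd s).hasDerivWithinAt) hbound (Set.left_mem_Icc.2 ht) (Set.right_mem_Icc.2 ht)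
  simp only [mul_zero, Real.exp_zero, one_mul, sub_zero, Real.norm_eq_abs, abs_of_nonneg ht] at h
  have hu0 : u 0 = ∫ X, bulkCurrent ω X * φ X ∂gibbs ω γ T N := by
    simp only [hu, flow_zero]
  rw [hu0] at h
  have he : Real.exp (-lam * t) * Real.exp (lam * t) = 1 := by rw [← Real.exp_add]; simp
  calc |u t - Real.exp (-lam * t) * ∫ X, bulkCurrent ω X * φ X ∂gibbs ω γ T N|
      = Real.exp (-lam * t) *
        |Real.exp (lam * t) * u t - ∫ X, bulkCurrent ω X * φ X ∂gibbs ω γ T N| := by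
        rw [← abs_of_pos (Real.exp_pos (-lam * t)), ← abs_mul, abs_of_pos (Real.exp_pos _)]
        congr 1
        linear_combination -(u t) * he
    _ ≤ Real.exp (-lam * t) *
        (ω ^ 4 * corrConst ω γ lam T * b * Real.exp ((lam - c) * t) * t) := by gcongr
    _ = ω ^ 4 * corrConst ω γ lam T * b *
        (t * (Real.exp (-lam * t) * Real.exp ((lam - c) * t))) := by ring
    _ = _ := by rw [← Real.exp_add]; congr 3; ring_nf

end

/-- The autocorrelation of the total current along the deterministic flow, averaged over the Gibbs
measure. -/
def flowCorrelation (ω γ lam T : ℝ) (N : ℕ) (t : ℝ) : ℝ :=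
  ∫ X, totalCurrent ω (flow ω γ lam N t X) * totalCurrent ω X ∂gibbs ω γ T N

lemma exists_integral_totalCurrent_sq_le {ω γ T r : ℝ} (hω : 0 < ω) (hγ : 0 < γ) (hT : 0 < T)
    (hr : 0 < r) (hr1 : r < 1) (h : ω ^ 2 * (r + 1 / r) = 2 * ω ^ 2 + γ ^ 2) :
    ∃ B : ℝ, 0 < B ∧ ∀ N : ℕ,
      ∫ X, bulkCurrent ω X ^ 2 ∂gibbs ω γ T N ≤ (B * √((N : ℝ) + 1)) ^ 2 ∧
      ∫ X, totalCurrent ω X ^ 2 ∂gibbs ω γ T N ≤ (B * √((N : ℝ) + 1)) ^ 2 := by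
  obtain ⟨K, hK⟩ := (tendsto_integral_bulkCurrent_sq hω hγ hT hr hr1 h).bddAbove_range
  have hK' (N : ℕ) : ∫ X, bulkCurrent ω X ^ 2 ∂gibbs ω γ T N ≤ K * ((N : ℝ) + 1) := by
    have := hK ⟨N, rfl⟩
    beta_reduce at this
    rwa [one_div, inv_mul_le_iff₀ (by positivity), mul_comm] at this
  have hK0 : 0 ≤ K := by
    have h0 : 0 ≤ ∫ X, bulkCurrent ω X ^ 2 ∂gibbs ω γ T 0 := integral_nonneg fun _ => sq_nonneg _
    have := hK' 0
    simp only [Nat.cast_zero, zero_add, mul_one] at this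
    linarith
  -- The edge moments are static: they are the flow bounds at time `0`, where the friction plays no
  -- role and may be set to `1`.
  have hcp := corrConst_pos ω 1 hγ hT
  have hE (N : ℕ) : ∫ X, edgeCurrent X ^ 2 ∂gibbs ω γ T N ≤ 4 * corrConst ω γ 1 T ^ 2 := by
    have hp (k : ℕ) : ∫ X, (pos X k * mom X k) ^ 2 ∂gibbs ω γ T N ≤ corrConst ω γ 1 T ^ 2 := by
      have := integral_mul_sq_le (ω := ω) hγ hT _ _
        (normSq_posL_flow_le (N := N) ω γ 1 hω.ne' hγ one_pos k le_rfl)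
        (normSq_momL_flow_le (N := N) ω γ 1 hω.ne' hγ one_pos k le_rfl)
      simpa only [ContinuousLinearMap.comp_apply, posL_apply, momL_apply, flow_zero, mul_zero,
        Real.exp_zero, mul_one, corrConst] using this
    calc ∫ X, edgeCurrent X ^ 2 ∂gibbs ω γ T N
        ≤ ∫ X, (2 * (pos X N * mom X N) ^ 2 + 2 * (pos X 1 * mom X 1) ^ 2) ∂gibbs ω γ T N := by
          refine integral_mono (integrable_gibbs hγ hT (by fun_prop))
            (integrable_gibbs hγ hT (by fun_prop)) fun X => ?_
          simp only [edgeCurrent]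
          nlinarith [sq_nonneg (pos X N * mom X N + pos X 1 * mom X 1)]
      _ = 2 * ∫ X, (pos X N * mom X N) ^ 2 ∂gibbs ω γ T N +
          2 * ∫ X, (pos X 1 * mom X 1) ^ 2 ∂gibbs ω γ T N := by
          rw [integral_add (integrable_gibbs hγ hT (by fun_prop))
            (integrable_gibbs hγ hT (by fun_prop)), integral_const_mul, integral_const_mul]
      _ ≤ _ := by linarith [hp N, hp 1]
  have hJ (N : ℕ) : ∫ X, totalCurrent ω X ^ 2 ∂gibbs ω γ T N ≤
      2 * ∫ X, bulkCurrent ω X ^ 2 ∂gibbs ω γ T N +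
        ω ^ 4 / 2 * ∫ X, edgeCurrent X ^ 2 ∂gibbs ω γ T N := by
    rw [← integral_const_mul, ← integral_const_mul,
      ← integral_add (integrable_gibbs hγ hT (by fun_prop)) (integrable_gibbs hγ hT (by fun_prop))]
    refine integral_mono (integrable_gibbs hγ hT (by fun_prop))
      (integrable_gibbs hγ hT (by fun_prop)) fun X => ?_
    simp only [totalCurrent_eq]
    nlinarith [sq_nonneg (bulkCurrent ω X + ω ^ 2 / 2 * edgeCurrent X)]
  set M := 2 * K + 2 * ω ^ 4 * corrConst ω γ 1 T ^ 2
  have hM : 0 < M := by positivity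
  refine ⟨√M, by positivity, fun N => ?_⟩
  have hN : (0 : ℝ) ≤ N := Nat.cast_nonneg N
  have h4 : 0 ≤ ω ^ 4 * corrConst ω γ 1 T ^ 2 := by positivity
  rw [mul_pow, Real.sq_sqrt hM.le, Real.sq_sqrt (by positivity)]
  have hKN : 0 ≤ K * ((N : ℝ) + 1) := by positivity
  constructor
  · refine (hK' N).trans ?_
    simp only [M]
    nlinarith
  · refine (hJ N).trans ?_
    have h5 := mul_le_mul_of_nonneg_left (hE N) (by positivity : 0 ≤ ω ^ 4 / 2)
    have h6 := hK' N
    simp only [M]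
    nlinarith

/-- Three errors are added: the boundary terms driving the bulk current, the edge current at time
`t`, and the edge current at time `0`. Each pairs an `O(1)` observable with one of norm `O(√N)`. -/
lemma exists_abs_flowCorrelation_sub_le {ω γ lam T r : ℝ} (hω : 0 < ω) (hγ : 0 < γ)
    (hlam : 0 < lam) (hT : 0 < T) (hr : 0 < r) (hr1 : r < 1)
    (h : ω ^ 2 * (r + 1 / r) = 2 * ω ^ 2 + γ ^ 2) :
    ∃ K : ℝ, 0 ≤ K ∧ ∀ (N : ℕ) (t : ℝ), 0 ≤ t →
      |flowCorrelation ω γ lam T N t -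
          Real.exp (-lam * t) * ∫ X, bulkCurrent ω X ^ 2 ∂gibbs ω γ T N| ≤
        K * √((N : ℝ) + 1) * ((1 + t) * Real.exp (-decayRate γ lam * t)) := by
  obtain ⟨B, hB, hBN⟩ := exists_integral_totalCurrent_sq_le hω hγ hT hr hr1 h
  have hcp := corrConst_pos ω lam hγ hT
  refine ⟨(2 * ω ^ 2 + ω ^ 4) * corrConst ω γ lam T * B, by positivity, fun N t ht => ?_⟩
  set b := B * √((N : ℝ) + 1) with hbdef
  have hb : 0 < b := by positivity
  set E := Real.exp (-decayRate γ lam * t)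
  have tJ := hasTemperateGrowth_totalCurrent (N := N) ω
  have tB := hasTemperateGrowth_bulkCurrent (N := N) ω
  have t₀ := (flow ω γ lam N t).hasTemperateGrowth
  have te : Function.HasTemperateGrowth fun X => edgeCurrent (flow ω γ lam N t X) :=
    hasTemperateGrowth_edgeCurrent.comp t₀
  have tb : Function.HasTemperateGrowth fun X => bulkCurrent ω (flow ω γ lam N t X) :=
    (hasTemperateGrowth_bulkCurrent ω).comp t₀
  have h1 := abs_integral_bulkCurrent_flow_sub_le hω.ne' hγ hlam hT hb ht tJ (hBN N).2
  have h2 := abs_integral_edgeCurrent_flow_le hω.ne' hγ hlam hT hb ht tJ (hBN N).2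
  have h3 := abs_integral_edgeCurrent_flow_le hω.ne' hγ hlam hT hb le_rfl tB (hBN N).1
  simp only [flow_zero, mul_zero, Real.exp_zero, mul_one] at h3
  have e1 : flowCorrelation ω γ lam T N t =
      ∫ X, bulkCurrent ω (flow ω γ lam N t X) * totalCurrent ω X ∂gibbs ω γ T N - ω ^ 2 / 2 *
        ∫ X, edgeCurrent (flow ω γ lam N t X) * totalCurrent ω X ∂gibbs ω γ T N := by
    rw [← integral_const_mul, ← integral_sub (integrable_gibbs hγ hT (by fun_prop))
      (integrable_gibbs hγ hT (by fun_prop)), flowCorrelation]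
    simp only [totalCurrent_eq ω (flow ω γ lam N t _), sub_mul, mul_assoc]
  have e2 : ∫ X, bulkCurrent ω X * totalCurrent ω X ∂gibbs ω γ T N =
      ∫ X, bulkCurrent ω X ^ 2 ∂gibbs ω γ T N - ω ^ 2 / 2 *
        ∫ X, edgeCurrent X * bulkCurrent ω X ∂gibbs ω γ T N := by
    rw [← integral_const_mul, ← integral_sub (integrable_gibbs hγ hT (by fun_prop))
      (integrable_gibbs hγ hT (by fun_prop))]
    refine integral_congr_ae (Eventually.of_forall fun X => ?_)
    simp only [totalCurrent_eq]
    ring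
  rw [e2] at h1
  rw [e1]
  have hexp : Real.exp (-lam * t) ≤ E :=
    Real.exp_le_exp.2 (by nlinarith [decayRate_le γ hlam])
  set I1 := ∫ X, bulkCurrent ω (flow ω γ lam N t X) * totalCurrent ω X ∂gibbs ω γ T N
  set I2 := ∫ X, edgeCurrent (flow ω γ lam N t X) * totalCurrent ω X ∂gibbs ω γ T N
  set I3 := ∫ X, edgeCurrent X * bulkCurrent ω X ∂gibbs ω γ T N
  set I4 := ∫ X, bulkCurrent ω X ^ 2 ∂gibbs ω γ T N
  set F := Real.exp (-lam * t)
  have hF : 0 ≤ F := (Real.exp_pos _).le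
  have hE : 0 ≤ E := (Real.exp_pos _).le
  have h4 : |F * (ω ^ 2 / 2 * I3)| ≤ E * (ω ^ 2 / 2 * (2 * (corrConst ω γ lam T * b))) := by
    rw [abs_mul, abs_mul, abs_of_nonneg hF, abs_of_nonneg (by positivity : 0 ≤ ω ^ 2 / 2)]
    gcongr
  have h5 : |ω ^ 2 / 2 * I2| ≤ ω ^ 2 / 2 * (2 * (corrConst ω γ lam T * E * b)) := by
    rw [abs_mul, abs_of_nonneg (by positivity : 0 ≤ ω ^ 2 / 2)]
    gcongr
  calc |I1 - ω ^ 2 / 2 * I2 - F * I4|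
      = |(I1 - F * (I4 - ω ^ 2 / 2 * I3)) - F * (ω ^ 2 / 2 * I3) - ω ^ 2 / 2 * I2| := by
        congr 1; ring
    _ ≤ |I1 - F * (I4 - ω ^ 2 / 2 * I3)| + |F * (ω ^ 2 / 2 * I3)| + |ω ^ 2 / 2 * I2| :=
        (abs_sub _ _).trans (add_le_add_left (abs_sub _ _) _)
    _ ≤ ω ^ 4 * corrConst ω γ lam T * b * (t * E) +
        E * (ω ^ 2 / 2 * (2 * (corrConst ω γ lam T * b))) +
        ω ^ 2 / 2 * (2 * (corrConst ω γ lam T * E * b)) := add_le_add (add_le_add h1 h4) h5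
    _ = (ω ^ 4 * t + 2 * ω ^ 2) * (corrConst ω γ lam T * b * E) := by ring
    _ ≤ ((2 * ω ^ 2 + ω ^ 4) * (1 + t)) * (corrConst ω γ lam T * b * E) := by
        gcongr
        nlinarith [mul_nonneg (sq_nonneg ω) ht, sq_nonneg (ω ^ 2)]
    _ = _ := by rw [hbdef]; ring

/-! ### Riemann sums -/

lemma tendsto_riemann_sum {f : ℝ → ℝ} (hf : Continuous f) {t : ℝ} (ht : 0 ≤ t) :
    Tendsto (fun n : ℕ => ∑ k ∈ Finset.range (n + 1), t / ((n : ℝ) + 1) * f (t / ((n : ℝ) + 1) * k))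
      atTop (𝓝 (∫ r in (0 : ℝ)..t, f r)) := by
  rw [Metric.tendsto_atTop]
  intro ε hε
  -- The shift by `1` allows `t = 0`.
  set η := ε / (2 * (t + 1))
  have hη : 0 < η := by positivity
  have huc : UniformContinuousOn f (Set.Icc 0 t) :=
    isCompact_Icc.uniformContinuousOn_of_continuous hf.continuousOn
  obtain ⟨δ, hδ, hfδ⟩ := Metric.uniformContinuousOn_iff_le.1 huc η hη
  obtain ⟨n₀, hn₀⟩ := exists_nat_gt (t / δ)
  refine ⟨n₀, fun n hn => ?_⟩
  have hn1 : (0 : ℝ) < (n : ℝ) + 1 := by positivity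
  set h := t / ((n : ℝ) + 1) with hh
  have hh0 : 0 ≤ h := by positivity
  have hhδ : h ≤ δ := by
    rw [hh, div_le_iff₀ hn1]
    have : (n₀ : ℝ) ≤ n := by exact_mod_cast hn
    rw [div_lt_iff₀ hδ] at hn₀
    nlinarith
  have hsplit : ∫ r in (0 : ℝ)..t, f r =
      ∑ k ∈ Finset.range (n + 1), ∫ r in (h * (k : ℕ))..(h * ((k + 1 : ℕ) : ℝ)), f r := by
    rw [intervalIntegral.sum_integral_adjacent_intervals (a := fun k : ℕ => h * (k : ℝ))
      fun k _ => hf.intervalIntegrable _ _]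
    simp only [Nat.cast_zero, mul_zero]
    congr 1
    rw [hh]; push_cast; field_simp
  have hpiece (k : ℕ) (hk : k ∈ Finset.range (n + 1)) :
      |h * f (h * k) - ∫ r in (h * (k : ℕ))..(h * ((k + 1 : ℕ) : ℝ)), f r| ≤ η * h := by
    have e1 : h * f (h * k) = ∫ _ in (h * (k : ℕ))..(h * ((k + 1 : ℕ) : ℝ)), f (h * k) := by
      rw [intervalIntegral.integral_const, smul_eq_mul]; push_cast; ring
    rw [e1, ← intervalIntegral.integral_sub (by simp) (hf.intervalIntegrable _ _)]
    have hle : h * (k : ℝ) ≤ h * ((k + 1 : ℕ) : ℝ) := by push_cast; nlinarith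
    have htop : h * ((k + 1 : ℕ) : ℝ) ≤ t := by
      have hk' : ((k + 1 : ℕ) : ℝ) ≤ (n : ℝ) + 1 := by
        exact_mod_cast Finset.mem_range.1 hk
      calc h * ((k + 1 : ℕ) : ℝ) ≤ h * ((n : ℝ) + 1) := by gcongr
        _ = t := by rw [hh]; field_simp
    have hb := intervalIntegral.norm_integral_le_of_norm_le_const (a := h * (k : ℝ))
      (b := h * ((k + 1 : ℕ) : ℝ)) (f := fun r => f (h * k) - f r) (C := η) fun r hr => by
        rw [Set.uIoc_of_le hle] at hr
        have hk0 : 0 ≤ h * (k : ℝ) := by positivity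
        have := hfδ (h * k) ⟨hk0, hle.trans htop⟩ r ⟨hk0.trans hr.1.le, hr.2.trans htop⟩ (by
          have := hr.2
          push_cast at this
          rw [Real.dist_eq, abs_le]
          constructor <;> linarith [hr.1])
        rwa [Real.dist_eq] at this
    rw [Real.norm_eq_abs] at hb
    refine hb.trans_eq ?_
    have e2 : h * ((k + 1 : ℕ) : ℝ) - h * k = h := by push_cast; ring
    rw [e2, abs_of_nonneg hh0]
  rw [Real.dist_eq, hsplit, ← Finset.sum_sub_distrib]
  calc _ ≤ ∑ k ∈ Finset.range (n + 1), η * h :=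
        (Finset.abs_sum_le_sum_abs _ _).trans (Finset.sum_le_sum hpiece)
    _ = η * t := by
        rw [Finset.sum_const, Finset.card_range, nsmul_eq_mul, hh]; push_cast; field_simp
    _ < ε := by
        simp only [η]
        rw [div_mul_eq_mul_div, div_lt_iff₀ (by positivity)]
        nlinarith

/-! ### Integrals of Brownian paths -/

section Brownian

variable {S : Type*} [MeasurableSpace S] {P : Measure S}

lemma integrable_sq_of_isBrownianReal {W : ℝ≥0 → S → ℝ} (hW : IsBrownianReal W P) (u : ℝ≥0) :
    Integrable (fun s => W u s ^ 2) P ∧ ∫ s, W u s ^ 2 ∂P = u := by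
  have hlaw := hW.hasLaw_eval u
  have hmem : MemLp id 2 (gaussianReal 0 u) := memLp_id_gaussianReal 2
  constructor
  · have h := hmem.integrable_sq
    rw [← hlaw.map_eq] at h
    exact h.comp_aemeasurable hlaw.aemeasurable
  · have h := hlaw.integral_comp (f := fun x : ℝ => x ^ 2) (by fun_prop)
    have hv := variance_fun_id_gaussianReal (μ := 0) (v := u)
    rw [variance_of_integral_eq_zero (by fun_prop) (by simp)] at hv
    rw [← hv]
    exact h

/-- Independence of `X(0)` concerns the product σ-algebra on paths, on which a path integral is not
obviously measurable. Riemann sums use finitely many path values, and their `limsup` is measurable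
on all paths. Square integrability follows from a uniform second moment bound and Fatou. -/
lemma exists_measurable_integral_brownian {W : ℝ≥0 → S → ℝ} (hW : IsBrownianReal W P)
    {κ : ℝ → ℝ} (hκ : Continuous κ) (t : ℝ≥0) :
    ∃ ρ : (ℝ≥0 → ℝ) → ℝ, Measurable ρ ∧
      (∀ᵐ s ∂P, ∫ r in (0 : ℝ)..t, κ r * W r.toNNReal s = ρ fun u => W u s) ∧
      MemLp (fun s => ∫ r in (0 : ℝ)..t, κ r * W r.toNNReal s) 2 P := by
  set R : ℕ → (ℝ≥0 → ℝ) → ℝ := fun n w => ∑ k ∈ Finset.range (n + 1),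
    (t : ℝ) / ((n : ℝ) + 1) * (κ (t / ((n : ℝ) + 1) * k) * w (t / ((n : ℝ) + 1) * k : ℝ).toNNReal)
    with hR
  have hRm (n : ℕ) : Measurable (R n) := by
    refine Finset.measurable_sum _ fun k _ => ?_
    exact ((measurable_pi_apply _).const_mul _).const_mul _
  have hlim : ∀ᵐ s ∂P, Tendsto (fun n => R n fun u => W u s) atTop
      (𝓝 (∫ r in (0 : ℝ)..t, κ r * W r.toNNReal s)) := by
    filter_upwards [hW.cont] with s hs
    exact tendsto_riemann_sum (f := fun r => κ r * W r.toNNReal s) (by fun_prop) t.2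
  refine ⟨fun w => limsup (fun n => R n w) atTop, Measurable.limsup hRm, ?_, ?_⟩
  · filter_upwards [hlim] with s hs
    exact hs.limsup_eq.symm
  have hRae (n : ℕ) : AEStronglyMeasurable (fun s => R n fun u => W u s) P := by
    refine AEMeasurable.aestronglyMeasurable ?_
    simp only [hR]
    refine Finset.aemeasurable_fun_sum _ fun k _ => ?_
    exact ((hW.aemeasurable _).const_mul _).const_mul _
  have hlimae := aestronglyMeasurable_of_tendsto_ae _ hRae hlim
  rw [memLp_two_iff_integrable_sq hlimae]
  obtain ⟨M, hM⟩ := (isCompact_Icc (a := (0 : ℝ)) (b := t)).exists_bound_of_continuousOn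
    hκ.continuousOn
  have hbound (n : ℕ) : Integrable (fun s => (R n fun u => W u s) ^ 2) P ∧
      ∫ s, (R n fun u => W u s) ^ 2 ∂P ≤ (t : ℝ) ^ 2 * M ^ 2 * t := by
    have hn1 : (0 : ℝ) < (n : ℝ) + 1 := by positivity
    set h := (t : ℝ) / ((n : ℝ) + 1) with hh
    have hh0 : 0 ≤ h := by positivity
    -- Cauchy–Schwarz for the sum: the `n + 1` terms and the number of summands combine with `h²` to
    -- `t²`, so no independence of increments is needed.
    have hpt (s : S) : (R n fun u => W u s) ^ 2 ≤ ∑ k ∈ Finset.range (n + 1),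
        ((n : ℝ) + 1) * (h ^ 2 * κ (h * k) ^ 2) * W (h * k : ℝ).toNNReal s ^ 2 := by
      simp only [hR]
      refine sq_sum_le_card_mul_sum_sq.trans_eq ?_
      rw [Finset.card_range, Finset.mul_sum]
      exact Finset.sum_congr rfl fun k _ => by push_cast; ring
    have hint (k : ℕ) : Integrable (fun s => ((n : ℝ) + 1) * (h ^ 2 * κ (h * k) ^ 2) *
        W (h * k : ℝ).toNNReal s ^ 2) P :=
      (integrable_sq_of_isBrownianReal hW _).1.const_mul _
    have hsum := integrable_finsetSum (Finset.range (n + 1)) fun k _ => hint k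
    have hsq : Integrable (fun s => (R n fun u => W u s) ^ 2) P :=
      hsum.mono' ((hRae n).pow 2) (Eventually.of_forall fun s => by
        rw [Real.norm_of_nonneg (sq_nonneg _)]; exact hpt s)
    refine ⟨hsq, (integral_mono hsq hsum hpt).trans ?_⟩
    rw [integral_finsetSum _ fun k _ => hint k]
    calc ∑ k ∈ Finset.range (n + 1), ∫ s, ((n : ℝ) + 1) * (h ^ 2 * κ (h * k) ^ 2) *
          W (h * k : ℝ).toNNReal s ^ 2 ∂P
        ≤ ∑ k ∈ Finset.range (n + 1), ((n : ℝ) + 1) * (h ^ 2 * M ^ 2) * t := by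
          refine Finset.sum_le_sum fun k hk => ?_
          rw [integral_const_mul, (integrable_sq_of_isBrownianReal hW _).2]
          have hk0 : 0 ≤ h * (k : ℝ) := by positivity
          have hk1 : h * (k : ℝ) ≤ t := by
            have : (k : ℝ) ≤ (n : ℝ) + 1 := by exact_mod_cast (Finset.mem_range.1 hk).le
            calc h * (k : ℝ) ≤ h * ((n : ℝ) + 1) := by gcongr
              _ = t := by rw [hh]; field_simp
          have hκM : κ (h * k) ^ 2 ≤ M ^ 2 := by
            have := hM (h * k) ⟨hk0, hk1⟩
            rw [← sq_abs]
            exact pow_le_pow_left₀ (abs_nonneg _) this 2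
          rw [Real.coe_toNNReal _ hk0]
          gcongr
      _ = (t : ℝ) ^ 2 * M ^ 2 * t := by
          rw [Finset.sum_const, Finset.card_range, nsmul_eq_mul, hh]; push_cast; field_simp
  rw [← memLp_one_iff_integrable]
  refine ⟨hlimae.pow 2, ?_⟩
  have hlim2 : ∀ᵐ s ∂P, Tendsto (fun n => (R n fun u => W u s) ^ 2) atTop
      (𝓝 ((∫ r in (0 : ℝ)..t, κ r * W r.toNNReal s) ^ 2)) := by
    filter_upwards [hlim] with s hs using hs.pow 2
  refine lt_of_le_of_lt (Lp.eLpNorm_lim_le_liminf_eLpNorm (fun n => (hRae n).pow 2) _ hlim2) ?_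
  refine lt_of_le_of_lt (liminf_le_liminf (v := fun _ =>
    ENNReal.ofReal ((t : ℝ) ^ 2 * M ^ 2 * t)) (Eventually.of_forall fun n => ?_)) (by simp)
  rw [eLpNorm_one_eq_lintegral_enorm]
  refine (ofReal_integral_norm_eq_lintegral_enorm (hbound n).1).symm.trans_le ?_
  refine ENNReal.ofReal_le_ofReal ?_
  simpa using (hbound n).2

end Brownian

/-! ### Variation of constants -/

/-- Pathwise Duhamel formula. The noise path is not differentiable, but `z = x - w` is;
differentiating `exp(-(t-s)A) z(s)` leaves only `w` under an ordinary integral, so no stochastic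
integral occurs. -/
lemma eq_flow_add_sub_integral (ω γ lam : ℝ) {x w : ℝ≥0 → Phase N} (hx : Continuous x)
    (h : ∀ t : ℝ≥0, x t = x 0 - (∫ r in (0 : ℝ)..t, driftMatrix ω γ lam N *ᵥ x r.toNNReal) + w t)
    (t : ℝ≥0) :
    x t = flow ω γ lam N t (x 0) + w t -
      ∫ r in (0 : ℝ)..t, flow ω γ lam N (t - r) (driftL ω γ lam N (w r.toNNReal)) := by
  set A := driftL ω γ lam N
  set y : ℝ → Phase N := fun r => x r.toNNReal
  have hy : Continuous y := hx.comp continuous_real_toNNReal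
  have hAy : Continuous fun r => A (y r) := A.continuous.comp hy
  set z : ℝ → Phase N := fun s => x 0 - ∫ r in (0 : ℝ)..s, A (y r)
  have hz (s : ℝ) : HasDerivAt z (-A (y s)) s :=
    (intervalIntegral.integral_hasDerivAt_right (hAy.intervalIntegrable _ _)
      hAy.aestronglyMeasurable.stronglyMeasurableAtFilter hAy.continuousAt).const_sub _
  have hzc : Continuous z := continuous_iff_continuousAt.2 fun s => (hz s).continuousAt
  have hzx (s : ℝ≥0) : x s - z s = w s := by
    have := h s
    simp only [z, y, A, driftL_apply]
    rw [this]
    abel_nf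
  have hd (s : ℝ) : HasDerivAt (fun s => flow ω γ lam N (t - s) (z s))
      (flow ω γ lam N (t - s) (A (z s - y s))) s := by
    have h1 : HasDerivAt (fun s : ℝ => (t : ℝ) - s) (-1) s := by
      simpa using (hasDerivAt_id s).const_sub (t : ℝ)
    have h2 := ((hasDerivAt_flow (N := N) ω γ lam (t - s)).scomp s h1).clm_apply (hz s)
    refine h2.congr_deriv ?_
    simp only [map_sub, map_neg, A, flow_driftL, Function.comp]
    simp [sub_eq_add_neg]
  have hflow : Continuous fun s : ℝ => flow ω γ lam N (t - s) :=
    (continuous_flow ω γ lam).comp (by fun_prop)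
  have hcont : Continuous fun s => flow ω γ lam N (t - s) (A (z s - y s)) :=
    hflow.clm_apply (A.continuous.comp (hzc.sub hy))
  have hint := intervalIntegral.integral_eq_sub_of_hasDerivAt (a := 0) (b := t)
    (fun s _ => hd s) (hcont.intervalIntegrable _ _)
  have hcongr : ∫ s in (0 : ℝ)..t, flow ω γ lam N (t - s) (A (z s - y s)) =
      -∫ r in (0 : ℝ)..t, flow ω γ lam N (t - r) (A (w r.toNNReal)) := by
    rw [← intervalIntegral.integral_neg]
    refine intervalIntegral.integral_congr fun s hs => ?_
    rw [Set.uIcc_of_le (NNReal.coe_nonneg t)] at hs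
    have hs' : ((s.toNNReal : ℝ≥0) : ℝ) = s := Real.coe_toNNReal _ hs.1
    have : z s - y s = -w s.toNNReal := by
      rw [← hzx s.toNNReal, hs']; simp only [y]; abel
    simp only [this, map_neg]
  rw [hcongr, sub_self, flow_zero, sub_zero] at hint
  have hz0 : z 0 = x 0 := by simp [z]
  rw [hz0] at hint
  have hzt : x t = z t + w t := by rw [← hzx t]; abel
  rw [hzt, sub_eq_add_neg _ (∫ r in (0 : ℝ)..t, _), hint]
  abel

/-! ### The law of the dynamics at a fixed time -/

lemma exists_indep_noise {ω γ lam : ℝ} {Θ : Fin N → ℝ} {S : Type*} [MeasurableSpace S]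
    {P : Measure S} {W : Site N → ℝ≥0 → S → ℝ} {X : ℝ≥0 → S → Phase N}
    (hX : IsLangevinDynamics ω γ lam Θ P W X) (t : ℝ≥0) :
    ∃ Z : S → Phase N, (∀ᵐ s ∂P, X t s = flow ω γ lam N t (X 0 s) + Z s) ∧
      IndepFun (X 0) Z P ∧ ∀ a, MemLp (fun s => Z s a) 2 P := by
  set Q := noiseMatrix lam Θ
  set κ : Site N → Site N → ℝ → ℝ := fun a i r =>
    flow ω γ lam N (t - r) (driftL ω γ lam N (Q *ᵥ Pi.single i 1)) a with hκdef
  have hκ (a i : Site N) : Continuous (κ a i) := by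
    have hflow : Continuous fun s : ℝ => flow ω γ lam N (t - s) :=
      (continuous_flow ω γ lam).comp (by fun_prop)
    exact (continuous_apply a).comp (hflow.clm_apply continuous_const)
  choose ρ hρm hρ hρL using fun a i => exists_measurable_integral_brownian (hX.brownian i) (hκ a i) t
  set F : (Site N → ℝ≥0 → ℝ) → Phase N := fun w a =>
    ∑ i, Q a i * w i t - ∑ i, ρ a i (w i) with hF
  have hFm : Measurable F := by
    refine measurable_pi_lambda _ fun a => ?_
    refine Measurable.sub (Finset.measurable_sum _ fun i _ => ?_)
      (Finset.measurable_sum _ fun i _ => (hρm a i).comp (measurable_pi_apply i))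
    fun_prop
  refine ⟨fun s => F fun i u => W i u s, ?_, ?_, fun a => ?_⟩
  · have hρ' : ∀ᵐ s ∂P, ∀ a i,
        ∫ r in (0 : ℝ)..t, κ a i r * W i r.toNNReal s = ρ a i fun u => W i u s :=
      ae_all_iff.2 fun a => ae_all_iff.2 fun i => hρ a i
    have hWc : ∀ᵐ s ∂P, ∀ i, Continuous fun u => W i u s :=
      ae_all_iff.2 fun i => (hX.brownian i).cont
    filter_upwards [hρ', hWc, hX.continuous_paths, hX.equation] with s hs hsW hsc hse
    have hw : Continuous fun u : ℝ≥0 => Q *ᵥ fun i => W i u s :=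
      Continuous.matrix_mulVec continuous_const (continuous_pi hsW)
    rw [eq_flow_add_sub_integral ω γ lam hsc hse t, add_sub_assoc]
    congr 1
    ext a
    have hflow : Continuous fun s : ℝ => flow ω γ lam N (t - s) :=
      (continuous_flow ω γ lam).comp (by fun_prop)
    have hI : IntervalIntegrable (fun r : ℝ => flow ω γ lam N (t - r)
        (driftL ω γ lam N (Q *ᵥ fun i => W i r.toNNReal s))) volume 0 t :=
      (hflow.clm_apply ((driftL ω γ lam N).continuous.comp
        (hw.comp continuous_real_toNNReal))).intervalIntegrable _ _
    have h1 := (ContinuousLinearMap.proj (R := ℝ) (φ := fun _ : Site N => ℝ)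
      a).intervalIntegral_comp_comm hI
    simp only [ContinuousLinearMap.proj_apply] at h1
    have h2 (r : ℝ) : flow ω γ lam N (t - r)
        (driftL ω γ lam N (Q *ᵥ fun i => W i r.toNNReal s)) a =
        ∑ i, κ a i r * W i r.toNNReal s := by
      have hv : (fun i => W i r.toNNReal s) =
          ∑ i, W i r.toNNReal s • (Pi.single i (1 : ℝ) : Phase N) := by
        ext c; simp [Finset.sum_apply, Pi.single_apply]
      rw [hv, Matrix.mulVec_sum, map_sum, map_sum, Finset.sum_apply]
      refine Finset.sum_congr rfl fun i _ => ?_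
      rw [Matrix.mulVec_smul, map_smul, map_smul, Pi.smul_apply, smul_eq_mul, mul_comm]
    simp only [h2] at h1
    rw [intervalIntegral.integral_finsetSum] at h1
    · simp only [Pi.sub_apply, hF, ← hs, h1]
      rfl
    · intro i _
      have := hsW i
      have := hκ a i
      exact Continuous.intervalIntegrable (by fun_prop) _ _
  · exact hX.indep_initial.comp measurable_id hFm
  · have h1 : MemLp (fun s => ∑ i, Q a i * W i t s -
        ∑ i, ∫ r in (0 : ℝ)..t, κ a i r * W i r.toNNReal s) 2 P := by
      refine MemLp.sub (memLp_finsetSum _ fun i _ => MemLp.const_mul ?_ _)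
        (memLp_finsetSum _ fun i _ => hρL a i)
      exact (memLp_two_iff_integrable_sq ((hX.brownian i).aemeasurable t).aestronglyMeasurable).2
        (integrable_sq_of_isBrownianReal (hX.brownian i) t).1
    refine h1.ae_eq ?_
    filter_upwards [ae_all_iff.2 fun i => hρ a i] with s hs
    simp only [hF, hs]

/-! ### Reduction of the equilibrium correlation to the flow -/

/-- The bilinear form of the total current. -/
def currentForm (ω : ℝ) (N : ℕ) : Phase N →L[ℝ] Phase N →L[ℝ] ℝ :=
  bulkForm ω N - (ω ^ 2 / 2) •
    ((posL N N).smulRight (momL N N) - (posL N 1).smulRight (momL N 1))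

lemma currentForm_self (ω : ℝ) (X : Phase N) : currentForm ω N X X = totalCurrent ω X := by
  simp [currentForm, totalCurrent_eq, bulkForm_self, edgeCurrent, posL_apply, momL_apply]

lemma totalCurrent_neg (ω : ℝ) (X : Phase N) : totalCurrent ω (-X) = totalCurrent ω X := by
  simp [← currentForm_self]

lemma integral_pos_mul_mom {ω γ T : ℝ} (hγ : 0 < γ) (hT : 0 < T) (j k : ℕ) :
    ∫ X, pos X j * mom X k ∂gibbs ω γ T N = 0 := by
  rcases k with _ | k
  · simp
  by_cases hk : k < N
  · have h := integral_energyForm_mul (ω := ω) hγ hT (Pi.single (Sum.inr ⟨k, hk⟩) 1) (posL N j)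
    simp only [energyForm_single_inr, posL_apply, pos_single_inr, mul_zero] at h
    simpa only [mul_comm] using h
  · simp [mom_of_lt _ (show N < k + 1 by omega)]

lemma integral_totalCurrent {ω γ T : ℝ} (hγ : 0 < γ) (hT : 0 < T) :
    ∫ X, totalCurrent ω X ∂gibbs ω γ T N = 0 := by
  have h (X : Phase N) (i : ℕ) : localCurrent ω X i = -(ω ^ 2 / 2) *
      (pos X (i + 1) * mom X i + pos X (i + 1) * mom X (i + 1) -
        (pos X i * mom X i + pos X i * mom X (i + 1))) := by
    rw [localCurrent]; ring
  simp only [totalCurrent, h]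
  rw [integral_finsetSum _ fun k _ => integrable_gibbs hγ hT (by fun_prop)]
  refine Finset.sum_eq_zero fun k _ => ?_
  rw [integral_const_mul, integral_sub (integrable_gibbs hγ hT (by fun_prop))
    (integrable_gibbs hγ hT (by fun_prop)), integral_add (integrable_gibbs hγ hT (by fun_prop))
    (integrable_gibbs hγ hT (by fun_prop)), integral_add (integrable_gibbs hγ hT (by fun_prop))
    (integrable_gibbs hγ hT (by fun_prop))]
  simp [integral_pos_mul_mom hγ hT]

/-! ### Averaging over the independent noise. -/

section

variable {ω γ T : ℝ} {S : Type*} [MeasurableSpace S] {P : Measure S} {Y Z : S → Phase N}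

lemma integrable_comp_of_hasLaw (hγ : 0 < γ) (hT : 0 < T) (hY : HasLaw Y (gibbs ω γ T N) P)
    {f : Phase N → ℝ} (hf : f.HasTemperateGrowth) : Integrable (fun s => f (Y s)) P := by
  have h := integrable_gibbs (ω := ω) hγ hT hf
  rw [← hY.map_eq] at h
  exact h.comp_aemeasurable hY.aemeasurable

lemma integral_comp_of_hasLaw (hY : HasLaw Y (gibbs ω γ T N) P) {f : Phase N → ℝ}
    (hf : f.HasTemperateGrowth) : ∫ s, f (Y s) ∂P = ∫ X, f X ∂gibbs ω γ T N :=
  hY.integral_comp hf.1.continuous.aestronglyMeasurable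

lemma integrable_mul_and_integral_eq_zero (hγ : 0 < γ) (hT : 0 < T)
    (hY : HasLaw Y (gibbs ω γ T N) P) (hYZ : IndepFun Y Z P) {ζ f : Phase N → ℝ}
    (hζ : Measurable ζ) (hζZ : Integrable (fun s => ζ (Z s)) P) (hf : f.HasTemperateGrowth)
    (hf0 : ∫ X, f X ∂gibbs ω γ T N = 0) :
    Integrable (fun s => ζ (Z s) * f (Y s)) P ∧ ∫ s, ζ (Z s) * f (Y s) ∂P = 0 := by
  have hind : IndepFun (fun s => ζ (Z s)) (fun s => f (Y s)) P :=
    hYZ.symm.comp hζ hf.1.continuous.measurable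
  have hfY := integrable_comp_of_hasLaw hγ hT hY hf
  refine ⟨hind.integrable_mul hζZ hfY, ?_⟩
  rw [hind.integral_fun_mul_eq_mul_integral hζZ.1 hfY.1, integral_comp_of_hasLaw hY hf, hf0,
    mul_zero]

lemma totalCurrent_add (X V : Phase N) : totalCurrent ω (X + V) = totalCurrent ω X +
    ∑ c, V c * (currentForm ω N X (Pi.single c 1) + currentForm ω N (Pi.single c 1) X) +
    ∑ c, ∑ d, V c * V d * currentForm ω N (Pi.single c 1) (Pi.single d 1) := by
  have hV : V = ∑ b, V b • (Pi.single b (1 : ℝ) : Phase N) := by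
    ext c; simp [Finset.sum_apply, Pi.single_apply]
  have h1 (X : Phase N) :
      currentForm ω N X V = ∑ c, V c * currentForm ω N X (Pi.single c 1) := by
    conv_lhs => rw [hV]
    simp only [map_sum, map_smul, smul_eq_mul]
  have h2 (X : Phase N) :
      currentForm ω N V X = ∑ c, V c * currentForm ω N (Pi.single c 1) X := by
    conv_lhs => rw [hV]
    simp only [map_sum, map_smul, _root_.sum_apply, _root_.smul_apply, smul_eq_mul]
  have h3 : currentForm ω N V V =
      ∑ c, ∑ d, V c * V d * currentForm ω N (Pi.single c 1) (Pi.single d 1) := by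
    rw [h2]
    refine Finset.sum_congr rfl fun c _ => ?_
    rw [h1, Finset.mul_sum]
    exact Finset.sum_congr rfl fun d _ => by ring
  simp only [← currentForm_self, map_add, _root_.add_apply]
  rw [h1 X, h2 X, h3]
  simp only [mul_add, Finset.sum_add_distrib]
  ring

/-- The terms linear in the noise vanish by parity under `X ↦ -X`, the quadratic ones because the
mean current is zero. Hence the covariance of the noise is irrelevant and only its second moments
need to be finite. -/
lemma integrable_and_integral_totalCurrent_mul (hγ : 0 < γ) (hT : 0 < T)
    (hY : HasLaw Y (gibbs ω γ T N) P) (hYZ : IndepFun Y Z P)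
    (hZ : ∀ a, MemLp (fun s => Z s a) 2 P) [IsProbabilityMeasure P]
    (U : Phase N →L[ℝ] Phase N) :
    Integrable (fun s => totalCurrent ω (U (Y s) + Z s) * totalCurrent ω (Y s)) P ∧
      ∫ s, totalCurrent ω (U (Y s) + Z s) * totalCurrent ω (Y s) ∂P =
        ∫ X, totalCurrent ω (U X) * totalCurrent ω X ∂gibbs ω γ T N := by
  have tU := U.hasTemperateGrowth
  have tJ := hasTemperateGrowth_totalCurrent (N := N) ω
  have tJU : Function.HasTemperateGrowth fun X => totalCurrent ω (U X) := tJ.comp tU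
  set β : Site N → Phase N → ℝ := fun c X =>
    currentForm ω N (U X) (Pi.single c 1) + currentForm ω N (Pi.single c 1) (U X)
  have tβ (c : Site N) : (β c).HasTemperateGrowth :=
    ((currentForm ω N).bilinear_hasTemperateGrowth tU (.const _)).add
      ((currentForm ω N).bilinear_hasTemperateGrowth (.const _) tU)
  have h1 (c : Site N) := integrable_mul_and_integral_eq_zero hγ hT hY hYZ
    (ζ := fun X => X c) (f := fun X => β c X * totalCurrent ω X) (measurable_pi_apply c)
    ((hZ c).integrable one_le_two) ((tβ c).mul tJ)
    (integral_gibbs_eq_zero_of_odd ω γ T fun X => by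
      simp only [β, totalCurrent_neg, map_neg, _root_.neg_apply]; ring)
  have h2 (c d : Site N) := integrable_mul_and_integral_eq_zero hγ hT hY hYZ
    (ζ := fun X => X c * X d) (f := fun X => currentForm ω N (Pi.single c 1) (Pi.single d 1) *
      totalCurrent ω X) ((measurable_pi_apply c).mul (measurable_pi_apply d))
    ((hZ c).integrable_mul (hZ d)) (by fun_prop)
    (by rw [integral_const_mul, integral_totalCurrent hγ hT, mul_zero])
  have t0 : Function.HasTemperateGrowth fun X => totalCurrent ω (U X) * totalCurrent ω X :=
    tJU.mul tJ
  have h0 := integrable_comp_of_hasLaw hγ hT hY t0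
  have heq (s : S) : totalCurrent ω (U (Y s) + Z s) * totalCurrent ω (Y s) =
      totalCurrent ω (U (Y s)) * totalCurrent ω (Y s) +
      ∑ c, Z s c * (β c (Y s) * totalCurrent ω (Y s)) +
      ∑ c, ∑ d, Z s c * Z s d *
        (currentForm ω N (Pi.single c 1) (Pi.single d 1) * totalCurrent ω (Y s)) := by
    rw [totalCurrent_add, add_mul, add_mul]
    simp only [Finset.sum_mul, mul_assoc, β]
  have i1 := integrable_finsetSum Finset.univ fun c _ => (h1 c).1
  have i2 := integrable_finsetSum Finset.univ fun c _ =>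
    integrable_finsetSum Finset.univ fun d _ => (h2 c d).1
  simp only [heq]
  refine ⟨(h0.add i1).add i2, ?_⟩
  have i01 := h0.add i1
  simp only [Pi.add_def] at i01
  rw [integral_add i01 i2, integral_add h0 i1, integral_finsetSum _ fun c _ => (h1 c).1,
    integral_finsetSum _ fun c _ => integrable_finsetSum Finset.univ fun d _ => (h2 c d).1]
  have e1 : ∑ c, ∫ s, Z s c * (β c (Y s) * totalCurrent ω (Y s)) ∂P = 0 :=
    Finset.sum_eq_zero fun c _ => (h1 c).2
  have e2 : ∑ c, ∫ s, ∑ d, Z s c * Z s d *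
      (currentForm ω N (Pi.single c 1) (Pi.single d 1) * totalCurrent ω (Y s)) ∂P = 0 := by
    refine Finset.sum_eq_zero fun c _ => ?_
    rw [integral_finsetSum _ fun d _ => (h2 c d).1]
    exact Finset.sum_eq_zero fun d _ => (h2 c d).2
  rw [e1, e2, add_zero, add_zero]
  exact integral_comp_of_hasLaw hY t0

lemma IsEquilibriumDynamics.integrable_and_integral [IsProbabilityMeasure P] {lam : ℝ}
    {W : Site N → ℝ≥0 → S → ℝ} {X : ℝ≥0 → S → Phase N}
    (hX : IsEquilibriumDynamics ω γ lam T P W X) (hγ : 0 < γ) (hT : 0 < T) (t : ℝ≥0) :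
    Integrable (fun s => totalCurrent ω (X t s) * totalCurrent ω (X 0 s)) P ∧
      ∫ s, totalCurrent ω (X t s) * totalCurrent ω (X 0 s) ∂P =
        flowCorrelation ω γ lam T N t := by
  obtain ⟨Z, hZX, hind, hZ⟩ := exists_indep_noise hX.toIsLangevinDynamics t
  have h := integrable_and_integral_totalCurrent_mul hγ hT hX.initial_law hind hZ
    (flow ω γ lam N t)
  have hae : (fun s => totalCurrent ω (flow ω γ lam N t (X 0 s) + Z s) * totalCurrent ω (X 0 s))
      =ᵐ[P] fun s => totalCurrent ω (X t s) * totalCurrent ω (X 0 s) := by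
    filter_upwards [hZX] with s hs
    rw [hs]
  exact ⟨h.1.congr hae, (integral_congr_ae hae).symm.trans h.2⟩

end

/-! ### The limit of large chains -/

lemma continuous_flowCorrelation {ω γ lam T : ℝ} (hγ : 0 < γ) (hT : 0 < T) :
    Continuous (flowCorrelation ω γ lam T N) := by
  refine continuous_iff_continuousAt.2 fun t => ?_
  have h := (hasDerivAt_integral_bilinear_flow (ω := ω) hγ hT lam (currentForm ω N)
    (hasTemperateGrowth_totalCurrent ω) t).continuousAt
  simp only [currentForm_self] at h
  exact h

lemma one_add_mul_exp_le {c t : ℝ} (hc : 0 < c) (ht : 0 ≤ t) :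
    (1 + t) * Real.exp (-c * t) ≤ (1 + 2 / c) * Real.exp (-(c / 2) * t) := by
  have h1 : 1 + t ≤ (1 + 2 / c) * Real.exp (c / 2 * t) := by
    have h2 := Real.add_one_le_exp (c / 2 * t)
    -- Half of the decay rate is spent on absorbing the polynomial factor.
    have h3 : (1 + 2 / c) * (c / 2 * t + 1) = 1 + t + c / 2 * t + 2 / c := by field_simp; ring
    have h4 : 0 ≤ c / 2 * t := by positivity
    have h5 : 0 < 2 / c := by positivity
    have h6 := mul_le_mul_of_nonneg_left h2 (by positivity : 0 ≤ 1 + 2 / c)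
    linarith
  calc (1 + t) * Real.exp (-c * t)
      ≤ (1 + 2 / c) * Real.exp (c / 2 * t) * Real.exp (-c * t) := by gcongr
    _ = _ := by rw [mul_assoc, ← Real.exp_add]; ring_nf

/-- The root `r < 1` of `r + 1 / r = 2 + γ² / ω²`. -/
def greenRatio (ω γ : ℝ) : ℝ :=
  2 / (2 + γ ^ 2 / ω ^ 2 + √(γ ^ 2 / ω ^ 2 * (4 + γ ^ 2 / ω ^ 2)))

lemma greenRatio_pos (ω γ : ℝ) : 0 < greenRatio ω γ := by
  rw [greenRatio]; positivity

lemma greenRatio_lt_one {ω γ : ℝ} (hω : 0 < ω) (hγ : 0 < γ) : greenRatio ω γ < 1 := by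
  have : 0 < γ ^ 2 / ω ^ 2 := by positivity
  have h := Real.sqrt_nonneg (γ ^ 2 / ω ^ 2 * (4 + γ ^ 2 / ω ^ 2))
  rw [greenRatio, div_lt_one (by positivity)]
  linarith

lemma greenRatio_spec {ω : ℝ} (hω : 0 < ω) (γ : ℝ) :
    ω ^ 2 * (greenRatio ω γ + 1 / greenRatio ω γ) = 2 * ω ^ 2 + γ ^ 2 := by
  set n := γ ^ 2 / ω ^ 2 with hn
  have hn0 : 0 ≤ n := by positivity
  have hγn : γ ^ 2 = ω ^ 2 * n := by rw [hn]; field_simp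
  have hs : √(n * (4 + n)) ^ 2 = n * (4 + n) := Real.sq_sqrt (by positivity)
  rw [greenRatio, ← hn, hγn]
  set s := √(n * (4 + n))
  have hs0 : 0 ≤ s := Real.sqrt_nonneg _
  have hD : 2 + n + s ≠ 0 := by positivity
  field_simp
  linear_combination hs

lemma conductivity_eq (ω γ lam : ℝ) :
    conductivity ω γ lam = ω ^ 2 * greenRatio ω γ / (2 * lam) := by
  rw [conductivity, greenRatio]; ring

/-- The error is of order `N^(-1/2)` with an integrable profile in `t`, so it settles both orders of
limit and integral without dominated convergence. -/
lemma exists_abs_flowCorrelation_div_sub_le {ω γ lam T : ℝ} (hω : 0 < ω) (hγ : 0 < γ)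
    (hlam : 0 < lam) (hT : 0 < T) :
    ∃ K c : ℝ, 0 ≤ K ∧ 0 < c ∧ ∀ (N : ℕ) (t : ℝ), 0 ≤ t →
      |1 / ((N : ℝ) + 1) * flowCorrelation ω γ lam T N t - Real.exp (-lam * t) *
          (1 / ((N : ℝ) + 1) * ∫ X, bulkCurrent ω X ^ 2 ∂gibbs ω γ T N)| ≤
        K / √((N : ℝ) + 1) * Real.exp (-c * t) := by
  obtain ⟨K, hK, h⟩ := exists_abs_flowCorrelation_sub_le hω hγ hlam hT (greenRatio_pos ω γ)
    (greenRatio_lt_one hω hγ) (greenRatio_spec hω γ)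
  have hc := decayRate_pos γ hlam
  set c := decayRate γ lam
  refine ⟨K * (1 + 2 / c), c / 2, by positivity, by positivity, fun N t ht => ?_⟩
  have hN : (0 : ℝ) < (N : ℝ) + 1 := by positivity
  have hs : √((N : ℝ) + 1) * √((N : ℝ) + 1) = (N : ℝ) + 1 := Real.mul_self_sqrt hN.le
  have hs0 : 0 < √((N : ℝ) + 1) := Real.sqrt_pos.2 hN
  rw [mul_left_comm, ← mul_sub, abs_mul, abs_of_nonneg (by positivity : 0 ≤ 1 / ((N : ℝ) + 1))]
  calc _ ≤ 1 / ((N : ℝ) + 1) * (K * √((N : ℝ) + 1) *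
        ((1 + 2 / c) * Real.exp (-(c / 2) * t))) := by
        gcongr
        exact (h N t ht).trans (mul_le_mul_of_nonneg_left (one_add_mul_exp_le hc ht) (by positivity))
    _ = (1 / ((N : ℝ) + 1) * √((N : ℝ) + 1)) * (K * (1 + 2 / c) * Real.exp (-(c / 2) * t)) := by
        ring
    _ = _ := by
        have : 1 / ((N : ℝ) + 1) * √((N : ℝ) + 1) = 1 / √((N : ℝ) + 1) := by
          rw [← hs]; field_simp; rw [Real.sqrt_sq hs0.le]
        rw [this]; ring

lemma tendsto_const_div_sqrt (K : ℝ) :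
    Tendsto (fun N : ℕ => K / √((N : ℝ) + 1)) atTop (𝓝 0) := by
  refine tendsto_const_nhds.div_atTop (Real.tendsto_sqrt_atTop.comp ?_)
  exact tendsto_atTop_add_const_right _ _ tendsto_natCast_atTop_atTop

lemma integral_exp_neg_mul {lam : ℝ} (hlam : 0 < lam) :
    ∫ t in Set.Ioi (0 : ℝ), Real.exp (-lam * t) = 1 / lam := by
  rw [integral_exp_mul_Ioi (neg_lt_zero.2 hlam)]
  simp

lemma integrableOn_flowCorrelation {ω γ lam T : ℝ} (hω : 0 < ω) (hγ : 0 < γ)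
    (hlam : 0 < lam) (hT : 0 < T) (N : ℕ) :
    IntegrableOn (fun t => 1 / ((N : ℝ) + 1) * flowCorrelation ω γ lam T N t) (Set.Ioi 0) := by
  obtain ⟨K, c, hK, hc, h⟩ := exists_abs_flowCorrelation_div_sub_le hω hγ hlam hT
  set m := 1 / ((N : ℝ) + 1) * ∫ X, bulkCurrent ω X ^ 2 ∂gibbs ω γ T N
  have hcont : Continuous fun t => 1 / ((N : ℝ) + 1) * flowCorrelation ω γ lam T N t -
      Real.exp (-lam * t) * m := by
    have := continuous_flowCorrelation (N := N) (ω := ω) (lam := lam) hγ hT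
    fun_prop
  have h1 : IntegrableOn (fun t => 1 / ((N : ℝ) + 1) * flowCorrelation ω γ lam T N t -
      Real.exp (-lam * t) * m) (Set.Ioi 0) := by
    refine ((exp_neg_integrableOn_Ioi 0 hc).const_mul (K / √((N : ℝ) + 1))).mono'
      hcont.aestronglyMeasurable.restrict ?_
    filter_upwards [ae_restrict_mem measurableSet_Ioi] with t ht
    exact h N t (le_of_lt ht)
  have h2 := h1.add ((exp_neg_integrableOn_Ioi 0 hlam).mul_const m)
  refine h2.congr (Eventually.of_forall fun t => ?_)
  simp

lemma tendsto_flowCorrelation {ω γ lam T : ℝ} (hω : 0 < ω) (hγ : 0 < γ)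
    (hlam : 0 < lam) (hT : 0 < T) {t : ℝ} (ht : 0 ≤ t) :
    Tendsto (fun N : ℕ => 1 / ((N : ℝ) + 1) * flowCorrelation ω γ lam T N t) atTop
      (𝓝 (T ^ 2 * lam * conductivity ω γ lam * Real.exp (-lam * t))) := by
  obtain ⟨K, c, hK, hc, h⟩ := exists_abs_flowCorrelation_div_sub_le hω hγ hlam hT
  have h1 := (tendsto_integral_bulkCurrent_sq hω hγ hT (greenRatio_pos ω γ)
    (greenRatio_lt_one hω hγ) (greenRatio_spec hω γ)).const_mul (Real.exp (-lam * t))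
  have hb (N : ℕ) : ‖1 / ((N : ℝ) + 1) * flowCorrelation ω γ lam T N t - Real.exp (-lam * t) *
      (1 / ((N : ℝ) + 1) * ∫ X, bulkCurrent ω X ^ 2 ∂gibbs ω γ T N)‖ ≤
      K / √((N : ℝ) + 1) * Real.exp (-c * t) := h N t ht
  have h2 := squeeze_zero_norm hb
    (by simpa only [zero_mul] using (tendsto_const_div_sqrt K).mul_const (Real.exp (-c * t)))
  have h3 := h2.add h1
  have hval : 0 + Real.exp (-lam * t) * (T ^ 2 * ω ^ 2 * greenRatio ω γ / 2) =
      T ^ 2 * lam * conductivity ω γ lam * Real.exp (-lam * t) := by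
    rw [conductivity_eq]; field_simp; ring
  rw [hval] at h3
  exact h3.congr fun N => by ring

lemma tendsto_integral_flowCorrelation {ω γ lam T : ℝ} (hω : 0 < ω) (hγ : 0 < γ)
    (hlam : 0 < lam) (hT : 0 < T) :
    Tendsto (fun N : ℕ => ∫ t in Set.Ioi (0 : ℝ),
      1 / ((N : ℝ) + 1) * flowCorrelation ω γ lam T N t) atTop
      (𝓝 (T ^ 2 * conductivity ω γ lam)) := by
  obtain ⟨K, c, hK, hc, h⟩ := exists_abs_flowCorrelation_div_sub_le hω hγ hlam hT
  set m : ℕ → ℝ := fun N => 1 / ((N : ℝ) + 1) * ∫ X, bulkCurrent ω X ^ 2 ∂gibbs ω γ T N with hm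
  have h1 : Tendsto m atTop _ := tendsto_integral_bulkCurrent_sq hω hγ hT (greenRatio_pos ω γ)
    (greenRatio_lt_one hω hγ) (greenRatio_spec hω γ)
  have hb (N : ℕ) : ‖(∫ t in Set.Ioi (0 : ℝ),
      1 / ((N : ℝ) + 1) * flowCorrelation ω γ lam T N t) - 1 / lam * m N‖ ≤
      K / √((N : ℝ) + 1) * (1 / c) := by
    have e1 : 1 / lam * m N = ∫ t in Set.Ioi (0 : ℝ), Real.exp (-lam * t) * m N := by
      rw [integral_mul_const, integral_exp_neg_mul hlam]
    rw [e1, ← integral_sub (integrableOn_flowCorrelation hω hγ hlam hT N)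
      ((exp_neg_integrableOn_Ioi 0 hlam).mul_const _), ← integral_exp_neg_mul hc,
      ← integral_const_mul]
    refine norm_integral_le_of_norm_le ((exp_neg_integrableOn_Ioi 0 hc).const_mul _) ?_
    filter_upwards [ae_restrict_mem measurableSet_Ioi] with t ht
    exact h N t (le_of_lt ht)
  have h2 := squeeze_zero_norm hb (by simpa only [zero_mul] using (tendsto_const_div_sqrt K).mul_const (1 / c))
  have h3 := h2.add (h1.const_mul (1 / lam))
  have hval : 0 + 1 / lam * (T ^ 2 * ω ^ 2 * greenRatio ω γ / 2) =
      T ^ 2 * conductivity ω γ lam := by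
    rw [conductivity_eq]; field_simp; ring
  rw [hval] at h3
  exact h3.congr fun N => by ring

end

end HarmonicChain

/-- Green–Kubo formula. The limit correlation `C` depends only on the parameters; the equilibrium
dynamics of `N` oscillators is any solution of the stochastic differential equation, on any
probability space `S N`, that starts from the Gibbs measure. -/
theorem theorem2 (ω γ lam T : ℝ) (hω : 0 < ω) (hγ : 0 < γ) (hlam : 0 < lam) (hT : 0 < T) :
    ∃ C : ℝ≥0 → ℝ,
      IntegrableOn (fun t : ℝ => C t.toNNReal) (Set.Ioi 0) ∧
      1 / T ^ 2 * (∫ t in Set.Ioi (0 : ℝ), C t.toNNReal) =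
        HarmonicChain.conductivity ω γ lam ∧
      ∀ (S : ℕ → Type*) [∀ N, MeasurableSpace (S N)] (P : ∀ N, Measure (S N))
        [∀ N, IsProbabilityMeasure (P N)]
        (W : ∀ N, HarmonicChain.Site N → ℝ≥0 → S N → ℝ)
        (X : ∀ N, ℝ≥0 → S N → HarmonicChain.Phase N),
        (∀ N, HarmonicChain.IsEquilibriumDynamics ω γ lam T (P N) (W N) (X N)) →
          (∀ N t, Integrable (fun s => HarmonicChain.totalCurrent ω (X N t s) *
            HarmonicChain.totalCurrent ω (X N 0 s)) (P N)) ∧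
          (∀ t : ℝ≥0, Tendsto
            (fun N => HarmonicChain.currentCorrelation ω (P N) (X N) t) atTop (𝓝 (C t))) ∧
          (∀ N, IntegrableOn (fun t : ℝ =>
            HarmonicChain.currentCorrelation ω (P N) (X N) t.toNNReal) (Set.Ioi 0)) ∧
          Tendsto (fun N => 1 / T ^ 2 * ∫ t in Set.Ioi (0 : ℝ),
              HarmonicChain.currentCorrelation ω (P N) (X N) t.toNNReal)
            atTop (𝓝 (HarmonicChain.conductivity ω γ lam)) := by
  open HarmonicChain in
  -- Truncation to nonnegative times is invisible on the domain of integration.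
  have hcoe : Set.EqOn (fun t : ℝ => T ^ 2 * lam * conductivity ω γ lam * Real.exp (-lam * t))
      (fun t : ℝ => T ^ 2 * lam * conductivity ω γ lam * Real.exp (-lam * (t.toNNReal : ℝ)))
      (Set.Ioi 0) := fun t ht => by
    simp only [Real.coe_toNNReal t (le_of_lt ht)]
  refine ⟨fun t => T ^ 2 * lam * conductivity ω γ lam * Real.exp (-lam * t), ?_, ?_, ?_⟩
  · exact IntegrableOn.congr_fun ((exp_neg_integrableOn_Ioi 0 hlam).const_mul _) hcoe
      measurableSet_Ioi
  · rw [← setIntegral_congr_fun measurableSet_Ioi hcoe, integral_const_mul,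
      integral_exp_neg_mul hlam]
    field_simp
  · intro S _ P _ W X hX
    have hcorr (N : ℕ) (t : ℝ≥0) : currentCorrelation ω (P N) (X N) t =
        1 / ((N : ℝ) + 1) * flowCorrelation ω γ lam T N t := by
      rw [currentCorrelation, ((hX N).integrable_and_integral hγ hT t).2]
    have hcorr' (N : ℕ) : Set.EqOn
        (fun t : ℝ => 1 / ((N : ℝ) + 1) * flowCorrelation ω γ lam T N t)
        (fun t : ℝ => currentCorrelation ω (P N) (X N) t.toNNReal) (Set.Ioi 0) := fun t ht => by
      simp only [hcorr, Real.coe_toNNReal t (le_of_lt ht)]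
    refine ⟨fun N t => ((hX N).integrable_and_integral hγ hT t).1, fun t => ?_, fun N => ?_, ?_⟩
    · simp only [hcorr]
      exact tendsto_flowCorrelation hω hγ hlam hT t.2
    · exact (integrableOn_flowCorrelation hω hγ hlam hT N).congr_fun (hcorr' N) measurableSet_Ioi
    · have h := (tendsto_integral_flowCorrelation hω hγ hlam hT).const_mul (1 / T ^ 2)
      have hval : 1 / T ^ 2 * (T ^ 2 * conductivity ω γ lam) = conductivity ω γ lam := by
        field_simp
      rw [hval] at h
      refine h.congr fun N => ?_
      rw [setIntegral_congr_fun measurableSet_Ioi (hcorr' N)]
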